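/- For $N\ge 1$ let $g=(g_{i,j})_{1\le i,j\le N}$ be IID standard Gaussian variables and let $H_N(\sigma)=\frac1{\sqrt N}\sum_{i,j=1}^N g_{i,j}\sigma_i\sigma_j$ for $\sigma\in\Sigma_N=\{-1,1\}^N$ be the Sherrington--Kirkpatrick Hamiltonian, identified with its coefficient vector $g\in\mathbb R^{N^2}$. Let $L_i(\sigma)=\sigma_i\,(H_N(\sigma)-H_N(\sigma\oplus e_i))/2$ be the local fields, where $\sigma\oplus e_i$ is $\sigma$ with its $i$-th coordinate flipped, and for $\gamma,\delta>0$ let $$S(\gamma,\delta;H_N)=\big\{\sigma\in\Sigma_N:\ |\{i:\sigma_iL_i(\sigma)<\gamma\}|\le\delta N\big\}$$ be the set of $(\gamma,\delta)$-gapped states. For $p\in[0,1]$, a pair $(H_N,H_{N,p})$ is $p$-correlated if $H_{N,p}$ has the coefficients $p\,g+\sqrt{1-p^2}\,g'$ with $g'$ an independent copy of $g$ (in law). An algorithm is a measurable function $\mathcal A:(H_N,\omega)\mapsto\sigma\in\Sigma_N$, where $\omega$ is a random element of a Polish space $\Omega_N$, independent of the Hamiltonians. It is $(L,\tau,p_{\mathrm{unstable}})$-stable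 if for all $p\in[0,1]$ and $p$-correlated $(H_N,H_{N,p})$, $$\mathbb P\big[\|\mathcal A(H_N,\omega)-\mathcal A(H_{N,p},\omega)\|/\sqrt N\ \ge\ L(1-p)^{1/4}+\tau\big]\le p_{\mathrm{unstable}},$$ with $\|\cdot\|$ the Euclidean norm. **Theorem.** For any $\gamma>0$ there exist $\delta=\delta(\gamma)>0$ and $\tau_0=\tau_0(\gamma,\delta)>0$ such that for every $0<\tau\le\tau_0$ and every $L>0$ there is $c=c(\gamma,\delta,\tau,L)>0$ with the following property. For every $p_{\mathrm{unstable}}\in[0,1]$ there is $N_0=N_0(\gamma,\delta,\tau,L,p_{\mathrm{unstable}})$ such that for all $N\ge N_0$, every $(L,\tau,p_{\mathrm{unstable}})$-stable algorithm $\mathcal A$ satisfies $$\mathbb P[\mathcal A(H_N,\omega)\in S(\gamma,\delta;H_N)]\le e^{-cN}+2\,p_{\mathrm{unstable}}^{\,c}.$$ -/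

import Mathlib

open MeasureTheory ProbabilityTheory

noncomputable section

namespace SK

/-- The disorder coefficients `(g i j)`, a point of `ℝ^(N²)`; a Hamiltonian is identified with them. -/
abbrev Disorder (N : ℕ) : Type := Fin N × Fin N → ℝ

/-- The discrete cube `{-1, 1}^N`. -/
abbrev Cube (N : ℕ) : Type := Fin N → ℤˣ

/-- The σ-algebra on spins is the discrete one. -/
instance : MeasurableSingletonClass ℤˣ where
  measurableSet_singleton u :=
    ⟨{(u : ℤ)}, measurableSet_singleton _, by ext v; simp [Units.ext_iff]⟩

/-- A spin configuration as a vector of the Euclidean space `ℝ^N`. -/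
def spinVec {N : ℕ} (σ : Cube N) : EuclideanSpace ℝ (Fin N) :=
  WithLp.toLp 2 fun i => (((σ i : ℤˣ) : ℤ) : ℝ)

/-- The Sherrington–Kirkpatrick Hamiltonian with disorder `g`. -/
def hamiltonian {N : ℕ} (g : Disorder N) (σ : Cube N) : ℝ :=
  (1 / √(N : ℝ)) * ∑ i, ∑ j, g (i, j) * spinVec σ i * spinVec σ j

/-- The configuration `σ ⊕ e_i`, which disagrees with `σ` precisely in coordinate `i`. -/
def flip {N : ℕ} (σ : Cube N) (i : Fin N) : Cube N :=
  Function.update σ i (-σ i)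

/-- The `i`-th local field of the Hamiltonian at `σ`. -/
def localField {N : ℕ} (g : Disorder N) (σ : Cube N) (i : Fin N) : ℝ :=
  spinVec σ i * (hamiltonian g σ - hamiltonian g (flip σ i)) / 2

/-- The set `S(γ, δ; H_N)` of `(γ, δ)`-gapped states. -/
def gappedStates {N : ℕ} (γ δ : ℝ) (g : Disorder N) : Set (Cube N) :=
  {σ | ((Finset.univ.filter fun i => spinVec σ i * localField g σ i < γ).card : ℝ) ≤ δ * N}

/-- The law of the disorder: IID standard Gaussian coefficients. -/
def law (N : ℕ) : Measure (Disorder N) :=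
  Measure.pi fun _ => gaussianReal 0 1

instance (N : ℕ) : IsProbabilityMeasure (law N) := by
  unfold law; infer_instance

/-- The joint law of a `p`-correlated pair `(H_N, H_{N,p})`, where
`H_{N,p} = p H_N + √(1 - p²) H'` for an independent copy `H'` of `H_N`. -/
def correlatedLaw (N : ℕ) (p : ℝ) : Measure (Disorder N × Disorder N) :=
  ((law N).prod (law N)).map fun x => (x.1, p • x.1 + √(1 - p ^ 2) • x.2)

/-- An algorithm: a measurable function of the disorder and of a seed `ω`. -/
structure Algorithm (N : ℕ) (Ω : Type*) [MeasurableSpace Ω] where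
  run : Disorder N × Ω → Cube N
  measurable_run : Measurable run

/-- `(L, τ, q)`-stability, when the seed has law `ν`. The same seed, independent of the pair of
Hamiltonians, is used on both of them. -/
def Algorithm.IsStable {N : ℕ} {Ω : Type*} [MeasurableSpace Ω] (A : Algorithm N Ω)
    (ν : Measure Ω) (L τ q : ℝ) : Prop :=
  ∀ p ∈ Set.Icc (0 : ℝ) 1,
    ((correlatedLaw N p).prod ν).real
      {x | L * (1 - p) ^ (1 / 4 : ℝ) + τ ≤
        ‖spinVec (A.run (x.1.1, x.2)) - spinVec (A.run (x.1.2, x.2))‖ / √(N : ℝ)} ≤ q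

/-- The probability that the algorithm outputs a `(γ, δ)`-gapped state. -/
def Algorithm.successProb {N : ℕ} {Ω : Type*} [MeasurableSpace Ω] (A : Algorithm N Ω)
    (ν : Measure Ω) (γ δ : ℝ) : ℝ :=
  ((law N).prod ν).real {x | A.run x ∈ gappedStates γ δ x.1}

end SK

end

/-! Along a slowly decorrelating chain of Hamiltonians, the outputs of a stable algorithm move in
small steps. An overlap gap then confines them near the starting output, while chaos forbids gapped
states near that output once the correlation has dropped to `exp (-1)`.

Overlap gap (`not_gapped_of_intermediate`). Let `σ`, `σ'` be gapped for `g` and `p g + q h`,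
disagree exactly on `J`, and let `T ⊆ J` be the sites stable for both. The stabilities summed over
`T` total at least `2γ|T| ≥ γ|J|`. With a single disorder `g`, the interactions of `T` with the
complement of `J` change sign between `σ` and `σ'` and cancel, leaving a form supported on `J × J`,
of variance `O(|J|²/N)`. A union bound shows that it is too small simultaneously for all `|J| ≤ ηN`.
The corrections from `1 - p` and from `h` are small once `|J| ≥ aN`, so no distance in `[aN, ηN]`
occurs.

Chaos (`exists_correlatedLaw_nearbyGapped_le`). If the second Hamiltonian contains enough
independent noise, resampling half of its rows makes linearly many sites unstable at any fixed
configuration, except with exponentially small probability. This survives a union bound over a ball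
of radius `rN` about the first output.

Chain. Take `K = W * 2^m` steps of correlation `exp (-1/K)` with one seed. Stability bounds each
step by `ηN/2`, so within a window of `2^m` steps the output cannot jump the gap and stays within
`aN` of the start of the window. Over `W` windows it moves at most `WaN = rN`, contradicting chaos.
If `P` is the success probability, symmetry and positivity of the noise operator give probability at
least `P^(2K)` that all `K + 1` outputs are gapped (`pow_prod_le_noiseLaw_prod`). Hence `P^(2K) ≤ K
* pUnstable + C exp (-c₀ N)`, and a `2K`-th root finishes. -/

namespace SK

open scoped NNReal ENNReal

/-! ### Linear forms of the Gaussian disorder -/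

theorem iIndepFun_eval_law (N : ℕ) :
    iIndepFun (fun (k : Fin N × Fin N) (g : Disorder N) => g k) (law N) := by
  unfold law
  exact iIndepFun_pi (X := fun _ x => x) (fun _ => aemeasurable_id)

theorem measurePreserving_eval_law {N : ℕ} (k : Fin N × Fin N) :
    MeasurePreserving (fun g : Disorder N => g k) (law N) (gaussianReal 0 1) := by
  unfold law
  exact measurePreserving_eval _ k

theorem hasGaussianLaw_eval_law {N : ℕ} (k : Fin N × Fin N) :
    HasGaussianLaw (fun g : Disorder N => g k) (law N) :=
  ⟨by rw [(measurePreserving_eval_law k).map_eq]; infer_instance⟩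

instance isGaussian_law (N : ℕ) : IsGaussian (law N) := by
  have h := (iIndepFun_eval_law N).hasGaussianLaw hasGaussianLaw_eval_law
  simpa using h.isGaussian_map

/-- The linear functional of the disorder with coefficients `v`. -/
def linForm {N : ℕ} (v : Fin N × Fin N → ℝ) : Disorder N →L[ℝ] ℝ :=
  ∑ k, v k • ContinuousLinearMap.proj k

theorem linForm_apply {N : ℕ} (v : Fin N × Fin N → ℝ) (g : Disorder N) :
    linForm v g = ∑ k, v k * g k := by
  simp [linForm]

theorem memLp_eval_law {N : ℕ} (k : Fin N × Fin N) :
    MemLp (fun g : Disorder N => g k) 2 (law N) :=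
  (hasGaussianLaw_eval_law k).memLp_two

theorem integral_eval_law {N : ℕ} (k : Fin N × Fin N) : ∫ g, g k ∂(law N) = 0 := by
  rw [← integral_id_gaussianReal (μ := 0) (v := 1), ← (measurePreserving_eval_law k).map_eq,
    integral_map (measurable_pi_apply k).aemeasurable (by fun_prop)]

theorem integral_linForm_law {N : ℕ} (v : Fin N × Fin N → ℝ) : ∫ g, linForm v g ∂(law N) = 0 := by
  simp_rw [linForm_apply]
  rw [integral_finsetSum _ fun k _ => ((memLp_eval_law k).integrable one_le_two).const_mul _]
  simp [integral_const_mul, integral_eval_law]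

theorem covariance_eval_law {N : ℕ} (k l : Fin N × Fin N) :
    cov[fun g => g k, fun g => g l; law N] = if k = l then 1 else 0 := by
  split_ifs with h
  · subst h
    rw [covariance_self (measurable_pi_apply k).aemeasurable]
    have := variance_map (μ := law N) (X := fun x : ℝ => x) (Y := fun g : Disorder N => g k)
      (by fun_prop) (measurable_pi_apply k).aemeasurable
    rw [(measurePreserving_eval_law k).map_eq] at this
    simpa [Function.comp_def] using this.symm
  · exact ((iIndepFun_eval_law N).indepFun h).covariance_eq_zero (memLp_eval_law k)
      (memLp_eval_law l)

theorem covariance_linForm_law {N : ℕ} (v w : Fin N × Fin N → ℝ) :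
    cov[fun g => linForm v g, fun g => linForm w g; law N] = ∑ k, v k * w k := by
  simp_rw [linForm_apply]
  rw [covariance_fun_sum_fun_sum (fun k => (memLp_eval_law k).const_mul _)
    (fun k => (memLp_eval_law k).const_mul _)]
  simp [covariance_const_mul_left, covariance_const_mul_right, covariance_eval_law, mul_comm]

theorem map_linForm_law {N : ℕ} (v : Fin N × Fin N → ℝ) :
    (law N).map (fun g => linForm v g) = gaussianReal 0 (∑ k, v k ^ 2).toNNReal := by
  have h : HasGaussianLaw (fun g => linForm v g) (law N) :=
    (IsGaussian.hasGaussianLaw_id (μ := law N)).map_fun (linForm v)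
  rw [h.map_eq_gaussianReal, integral_linForm_law,
    ← covariance_self (linForm v).continuous.aemeasurable, covariance_linForm_law]
  simp [sq]

/-- Gaussian upper tail of a linear functional whose variance is at most `V`. -/
theorem law_linForm_ge_le {N : ℕ} (v : Fin N × Fin N → ℝ) {V z : ℝ} (hV : ∑ k, v k ^ 2 ≤ V)
    (hV0 : 0 < V) (hz : 0 ≤ z) :
    (law N).real {g | z ≤ linForm v g} ≤ Real.exp (-z ^ 2 / (2 * V)) := by
  have hlaw := map_linForm_law v
  have hint : Integrable (fun g => Real.exp (z / V * linForm v g)) (law N) := by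
    have := integrable_exp_mul_gaussianReal (μ := 0) (v := (∑ k, v k ^ 2).toNNReal) (z / V)
    rw [← hlaw, integrable_map_measure (by fun_prop) (by fun_prop)] at this
    exact this
  refine (measure_ge_le_exp_mul_mgf z (div_nonneg hz hV0.le) hint).trans ?_
  rw [mgf_gaussianReal hlaw, ← Real.exp_add, Real.exp_le_exp,
    Real.coe_toNNReal _ (Finset.sum_nonneg fun k _ => sq_nonneg _)]
  have : (∑ k, v k ^ 2) * (z / V) ^ 2 / 2 ≤ V * (z / V) ^ 2 / 2 := by gcongr
  refine (add_le_add_right (add_le_add_right this _) _).trans (le_of_eq ?_)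
  field_simp
  ring

/-! ### Rotation invariance and correlated pairs -/

theorem measurePreserving_rotation_law {N : ℕ} {a b : ℝ} (hab : a ^ 2 + b ^ 2 = 1) :
    MeasurePreserving (fun x : Disorder N × Disorder N => (a • x.1 + b • x.2, -b • x.1 + a • x.2))
      ((law N).prod (law N)) ((law N).prod (law N)) := by
  have hcent : (law N)[id] = 0 := by
    ext k
    simp only [id, Pi.zero_apply]
    rw [eval_integral fun i => (memLp_eval_law i).integrable one_le_two, integral_eval_law k]
  obtain ⟨θ, rfl, rfl⟩ : ∃ θ, a = Real.cos θ ∧ b = Real.sin θ := by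
    have hn : ‖(⟨a, b⟩ : ℂ)‖ = 1 := by
      rw [Complex.norm_def, Complex.normSq_mk, ← sq, ← sq, hab, Real.sqrt_one]
    have h0 : (⟨a, b⟩ : ℂ) ≠ 0 := by intro h; simp [h] at hn
    refine ⟨Complex.arg ⟨a, b⟩, ?_, ?_⟩
    · rw [Complex.cos_arg h0, hn]; simp
    · rw [Complex.sin_arg, hn]; simp
  refine ⟨by fun_prop, ?_⟩
  convert IsGaussian.map_rotation_eq_self hcent θ using 2
  ext x : 1
  simp [ContinuousLinearMap.rotation_apply]

theorem measurePreserving_neg_law (N : ℕ) : MeasurePreserving (fun g => -g) (law N) (law N) := by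
  have h := (measurePreserving_fst (μ := law N) (ν := law N)).comp
    (measurePreserving_rotation_law (N := N) (a := -1) (b := 0) (by norm_num))
  have h2 := measurePreserving_fst (μ := law N) (ν := law N)
  refine ⟨by fun_prop, ?_⟩
  have h3 := h.map_eq
  rw [show (Prod.fst ∘ fun x : Disorder N × Disorder N =>
      ((-1 : ℝ) • x.1 + (0 : ℝ) • x.2, -(0 : ℝ) • x.1 + (-1 : ℝ) • x.2)) =
      (fun g => -g) ∘ Prod.fst by ext x; simp,
    ← Measure.map_map (by fun_prop) (by fun_prop), h2.map_eq] at h3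
  exact h3

theorem measurePreserving_add_law {N : ℕ} {a b : ℝ} (hab : a ^ 2 + b ^ 2 = 1) :
    MeasurePreserving (fun x : Disorder N × Disorder N => a • x.1 + b • x.2)
      ((law N).prod (law N)) (law N) :=
  measurePreserving_fst.comp (measurePreserving_rotation_law hab)

/-- The reflection `(x, y) ↦ (p x + q y, q x - p y)` with `q = √(1 - p²)` preserves the product law
and exchanges the two members of the pair. This is the reversibility of the chain. -/
theorem correlatedLaw_swap {N : ℕ} {p : ℝ} (hp : p ∈ Set.Icc (0 : ℝ) 1) :
    (correlatedLaw N p).map Prod.swap = correlatedLaw N p := by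
  have hq : 0 ≤ 1 - p ^ 2 := by nlinarith [hp.1, hp.2]
  have hab : p ^ 2 + (√(1 - p ^ 2)) ^ 2 = 1 := by rw [Real.sq_sqrt hq]; ring
  have hrefl := ((MeasurePreserving.id (law N)).prod (measurePreserving_neg_law N)).comp
    (measurePreserving_rotation_law (N := N) hab)
  unfold correlatedLaw
  conv_rhs => rw [← hrefl.map_eq]
  rw [Measure.map_map (by fun_prop) (by fun_prop), Measure.map_map (by fun_prop) (by fun_prop)]
  congr 1
  ext x k
  · simp
  · simp only [Function.comp_apply, Prod.swap_prod_mk, Prod.map, id, Pi.add_apply, Pi.smul_apply,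
      Pi.neg_apply, smul_eq_mul]
    linear_combination x.1 k * (-hab)

/-- Correlating once more with a fresh copy multiplies the correlations. -/
theorem measurePreserving_correlatedLaw_step {N : ℕ} {a p : ℝ} (ha : a ∈ Set.Icc (0 : ℝ) 1)
    (hp : p ∈ Set.Icc (0 : ℝ) 1) :
    MeasurePreserving (fun x : (Disorder N × Disorder N) × Disorder N =>
      (x.1.1, p • x.1.2 + √(1 - p ^ 2) • x.2)) ((correlatedLaw N a).prod (law N))
      (correlatedLaw N (a * p)) := by
  have hqa : 0 ≤ 1 - a ^ 2 := by nlinarith [ha.1, ha.2]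
  have hqp : 0 ≤ 1 - p ^ 2 := by nlinarith [hp.1, hp.2]
  have hap : a * p ≤ 1 := mul_le_one₀ ha.2 hp.1 hp.2
  have hap0 : 0 ≤ a * p := mul_nonneg ha.1 hp.1
  have hqap : 0 ≤ 1 - (a * p) ^ 2 := by nlinarith
  -- The two noise terms merge into `√(1 - (a p)²)` times a unit combination `α z + β z'`. When `a p
  -- = 1` there is no noise and any unit vector serves.
  obtain ⟨α, β, hαβ, h1, h2⟩ : ∃ α β : ℝ, α ^ 2 + β ^ 2 = 1 ∧
      √(1 - (a * p) ^ 2) * α = p * √(1 - a ^ 2) ∧ √(1 - (a * p) ^ 2) * β = √(1 - p ^ 2) := by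
    rcases hqap.eq_or_lt with h | h
    · have h1 : a * p = 1 := by nlinarith
      have h2 : p = 1 := le_antisymm hp.2 (by nlinarith [ha.2, hp.1])
      have h3 : a = 1 := by simpa [h2] using h1
      exact ⟨1, 0, by norm_num, by simp [h2, h3], by simp [h2]⟩
    · have hs : √(1 - (a * p) ^ 2) ≠ 0 := (Real.sqrt_pos.2 h).ne'
      refine ⟨p * √(1 - a ^ 2) / √(1 - (a * p) ^ 2), √(1 - p ^ 2) / √(1 - (a * p) ^ 2), ?_,
        mul_div_cancel₀ _ hs,
        mul_div_cancel₀ _ hs⟩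
      rw [div_pow, div_pow, mul_pow, Real.sq_sqrt hqa, Real.sq_sqrt hqp, Real.sq_sqrt hqap,
        ← add_div, div_eq_one_iff_eq h.ne']
      ring
  have hmp := (MeasurePreserving.id (law N)).prod (measurePreserving_add_law (N := N) hαβ)
  have hcorr : ∀ r : ℝ, MeasurePreserving
      (fun x : Disorder N × Disorder N => (x.1, r • x.1 + √(1 - r ^ 2) • x.2))
      ((law N).prod (law N)) (correlatedLaw N r) := fun r => ⟨by fun_prop, rfl⟩
  have hA := (hcorr (a * p)).comp
    (hmp.comp (measurePreserving_prodAssoc (law N) (law N) (law N)))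
  have hB := (hcorr a).prod (MeasurePreserving.id (law N))
  refine ⟨by fun_prop, ?_⟩
  rw [← hB.map_eq, Measure.map_map (by fun_prop) (by fun_prop), ← hA.map_eq]
  congr 1
  ext x k
  · rfl
  · simp only [Function.comp_apply, Prod.map, id, Pi.add_apply, Pi.smul_apply, smul_eq_mul,
      MeasurableEquiv.prodAssoc, MeasurableEquiv.coe_mk, Equiv.prodAssoc_apply]
    linear_combination x.1.2 k * (-h1) + x.2 k * (-h2)

/-! ### Stabilities as bilinear forms, and cancellation on the set of disagreement -/

/-- Coefficients of the symmetrized off-diagonal bilinear form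
`N^(-1/2) ∑_{a ≠ b} g a b (y a * x b + y b * x a)`. -/
noncomputable def formCoeff {N : ℕ} (y x : Fin N → ℝ) (k : Fin N × Fin N) : ℝ :=
  (1 / √(N : ℝ)) * if k.1 = k.2 then 0 else y k.1 * x k.2 + y k.2 * x k.1

/-- The restriction of a vector to a set of coordinates. -/
noncomputable def restrictTo {N : ℕ} (T : Finset (Fin N)) (x : Fin N → ℝ) (i : Fin N) : ℝ :=
  if i ∈ T then x i else 0

theorem sum_formCoeff_sq_le {N : ℕ} (y x : Fin N → ℝ) :
    ∑ k, formCoeff y x k ^ 2 ≤ 4 / N * ((∑ i, y i ^ 2) * ∑ i, x i ^ 2) := by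
  have h1 : ∀ k : Fin N × Fin N, formCoeff y x k ^ 2 ≤
      2 / N * (y k.1 ^ 2 * x k.2 ^ 2 + y k.2 ^ 2 * x k.1 ^ 2) := by
    intro k
    unfold formCoeff
    rw [mul_pow, div_pow, Real.sq_sqrt (Nat.cast_nonneg N), one_pow]
    have : (0 : ℝ) ≤ 1 / N := by positivity
    have h2 : (if k.1 = k.2 then 0 else y k.1 * x k.2 + y k.2 * x k.1) ^ 2 ≤
        2 * (y k.1 ^ 2 * x k.2 ^ 2 + y k.2 ^ 2 * x k.1 ^ 2) := by
      split_ifs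
      · rw [zero_pow two_ne_zero]; positivity
      · nlinarith [sq_nonneg (y k.1 * x k.2 - y k.2 * x k.1)]
    calc _ ≤ 1 / (N : ℝ) * (2 * (y k.1 ^ 2 * x k.2 ^ 2 + y k.2 ^ 2 * x k.1 ^ 2)) := by gcongr
      _ = _ := by ring
  refine (Finset.sum_le_sum fun k _ => h1 k).trans (le_of_eq ?_)
  rw [← Finset.mul_sum, Finset.sum_add_distrib, Fintype.sum_prod_type, Fintype.sum_prod_type_right]
  simp_rw [← Finset.mul_sum, ← Finset.sum_mul]
  ring

theorem formCoeff_add_left {N : ℕ} (y y' x : Fin N → ℝ) :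
    formCoeff (y + y') x = formCoeff y x + formCoeff y' x := by
  ext k; simp only [formCoeff, Pi.add_apply]; split_ifs <;> ring

theorem formCoeff_zero_left {N : ℕ} (x : Fin N → ℝ) : formCoeff 0 x = 0 := by
  ext k; simp [formCoeff]

theorem formCoeff_sum_left {N : ℕ} {ι : Type*} (s : Finset ι) (y : ι → Fin N → ℝ) (x : Fin N → ℝ) :
    formCoeff (∑ i ∈ s, y i) x = ∑ i ∈ s, formCoeff (y i) x := by
  classical
  induction s using Finset.induction_on with
  | empty => simp [formCoeff_zero_left]
  | insert i s hi ih => rw [Finset.sum_insert hi, Finset.sum_insert hi, formCoeff_add_left, ih]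

theorem linForm_add {N : ℕ} (v w : Fin N × Fin N → ℝ) (g : Disorder N) :
    linForm (v + w) g = linForm v g + linForm w g := by
  simp [linForm_apply, add_mul, Finset.sum_add_distrib]

theorem linForm_smul {N : ℕ} (c : ℝ) (v : Fin N × Fin N → ℝ) (g : Disorder N) :
    linForm (c • v) g = c * linForm v g := by
  simp [linForm_apply, mul_assoc, Finset.mul_sum]

theorem linForm_sum {N : ℕ} {ι : Type*} (s : Finset ι) (v : ι → Fin N × Fin N → ℝ)
    (g : Disorder N) : linForm (∑ i ∈ s, v i) g = ∑ i ∈ s, linForm (v i) g := by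
  simp only [linForm_apply, Finset.sum_apply, Finset.sum_mul]
  exact Finset.sum_comm

theorem spinVec_sq {N : ℕ} (σ : Cube N) (i : Fin N) : spinVec σ i ^ 2 = 1 := by
  rcases Int.units_eq_one_or (σ i) with h | h <;> simp [spinVec, h]

theorem spinVec_flip {N : ℕ} (σ : Cube N) (i a : Fin N) :
    spinVec (flip σ i) a = if a = i then -spinVec σ a else spinVec σ a := by
  by_cases h : a = i
  · subst h; simp [spinVec, flip]
  · simp [spinVec, flip, h]

theorem restrictTo_eq_sum_single {N : ℕ} (T : Finset (Fin N)) (x : Fin N → ℝ) :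
    restrictTo T x = ∑ i ∈ T, Pi.single i (x i) := by
  ext j
  simp [restrictTo, Finset.sum_apply, Pi.single_apply]

/-- The stability `σ_i L_i(σ)` of a site. -/
noncomputable def stability {N : ℕ} (g : Disorder N) (σ : Cube N) (i : Fin N) : ℝ :=
  spinVec σ i * localField g σ i

/-- Flipping site `i` negates the terms with exactly one index equal to `i`. The diagonal term is
unchanged by the flip, which is why `formCoeff` vanishes on the diagonal. -/
theorem stability_eq_linForm {N : ℕ} (g : Disorder N) (σ : Cube N) (i : Fin N) :
    stability g σ i = linForm (formCoeff (Pi.single i (spinVec σ i)) (spinVec σ)) g := by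
  have h1 : stability g σ i = (hamiltonian g σ - hamiltonian g (flip σ i)) / 2 := by
    unfold stability localField
    have := spinVec_sq σ i
    linear_combination ((hamiltonian g σ - hamiltonian g (flip σ i)) / 2) * this
  rw [h1, linForm_apply, Fintype.sum_prod_type]
  unfold hamiltonian
  rw [← mul_sub, ← Finset.sum_sub_distrib, Finset.mul_sum, Finset.sum_div]
  refine Finset.sum_congr rfl fun a _ => ?_
  rw [← Finset.sum_sub_distrib, Finset.mul_sum, Finset.sum_div]
  refine Finset.sum_congr rfl fun b _ => ?_
  rw [spinVec_flip, spinVec_flip]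
  simp only [formCoeff, Pi.single_apply]
  have hs := spinVec_sq σ i
  split_ifs with h1 h2 h3 <;> first | (subst_vars; simp_all; done) | (subst_vars; ring)

theorem sum_stability_eq {N : ℕ} (g : Disorder N) (σ : Cube N) (T : Finset (Fin N)) :
    ∑ i ∈ T, stability g σ i =
      linForm (formCoeff (restrictTo T (spinVec σ)) (spinVec σ)) g := by
  rw [restrictTo_eq_sum_single, formCoeff_sum_left, linForm_sum]
  exact Finset.sum_congr rfl fun i _ => stability_eq_linForm g σ i

theorem stability_add_smul {N : ℕ} (g h : Disorder N) (a b : ℝ) (σ : Cube N) (i : Fin N) :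
    stability (a • g + b • h) σ i = a * stability g σ i + b * stability h σ i := by
  simp [stability_eq_linForm]

/-- The `±1` vector which is positive exactly on `P`. -/
noncomputable def signVec {N : ℕ} (P : Finset (Fin N)) (i : Fin N) : ℝ := if i ∈ P then 1 else -1

/-- The set of disagreement of two configurations. -/
def disagree {N : ℕ} (σ σ' : Cube N) : Finset (Fin N) := Finset.univ.filter fun i => σ i ≠ σ' i

theorem spinVec_of_mem_disagree {N : ℕ} {σ σ' : Cube N} {i : Fin N} (hi : i ∈ disagree σ σ') :
    spinVec σ' i = -spinVec σ i := by
  simp only [disagree, Finset.mem_filter, Finset.mem_univ, true_and] at hi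
  rcases Int.units_eq_one_or (σ i) with h | h <;> rcases Int.units_eq_one_or (σ' i) with h' | h' <;>
    simp_all [spinVec]

theorem spinVec_of_notMem_disagree {N : ℕ} {σ σ' : Cube N} {i : Fin N}
    (hi : i ∉ disagree σ σ') : spinVec σ' i = spinVec σ i := by
  simp only [disagree, Finset.mem_filter, Finset.mem_univ, true_and, not_not] at hi
  simp [spinVec, hi]

/-- On sites of disagreement the two stabilities at the same disorder add up to a form
supported on the set of disagreement. -/
theorem sum_stability_add_stability {N : ℕ} (g : Disorder N) (σ σ' : Cube N)
    {T : Finset (Fin N)} (hT : T ⊆ disagree σ σ') :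
    ∃ P ⊆ disagree σ σ', ∑ i ∈ T, (stability g σ i + stability g σ' i) =
      2 * linForm (formCoeff (restrictTo T (signVec P))
        (restrictTo (disagree σ σ') (signVec P))) g := by
  classical
  -- On the set of disagreement `signVec P` is `σ` itself. The form thus depends on `σ` only through
  -- `P`, leaving few cases for the later union bound.
  refine ⟨(disagree σ σ').filter fun i => σ i = 1, Finset.filter_subset _ _, ?_⟩
  rw [Finset.sum_add_distrib, sum_stability_eq, sum_stability_eq, ← linForm_add, ← linForm_smul]
  congr 2
  have hs : ∀ i ∈ disagree σ σ',
      signVec ((disagree σ σ').filter fun i => σ i = 1) i = spinVec σ i := by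
    intro i hi
    rcases Int.units_eq_one_or (σ i) with h | h <;> simp [signVec, hi, h, spinVec]
  have hy : restrictTo T (signVec ((disagree σ σ').filter fun i => σ i = 1)) =
      restrictTo T (spinVec σ) := by
    ext i
    by_cases hi : i ∈ T
    · simp [restrictTo, hi, hs i (hT hi)]
    · simp [restrictTo, hi]
  rw [hy]
  ext k
  simp only [formCoeff, Pi.add_apply, Pi.smul_apply, smul_eq_mul]
  split_ifs with hk
  · simp
  -- For `a ∈ T`, both factors change sign if `b` is a disagreement, and the product doubles;
  -- otherwise only the first does, and the two products cancel.
  have key : ∀ a b, restrictTo T (spinVec σ) a * spinVec σ b +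
      restrictTo T (spinVec σ') a * spinVec σ' b = 2 * (restrictTo T (spinVec σ) a *
      restrictTo (disagree σ σ') (signVec ((disagree σ σ').filter fun i => σ i = 1)) b) := by
    intro a b
    by_cases ha : a ∈ T
    · by_cases hb : b ∈ disagree σ σ'
      · simp only [restrictTo, ha, hb, if_true, hs b hb, spinVec_of_mem_disagree (hT ha),
          spinVec_of_mem_disagree hb]
        ring
      · simp only [restrictTo, ha, hb, if_true, if_false, spinVec_of_mem_disagree (hT ha),
          spinVec_of_notMem_disagree hb]
        ring
    · simp [restrictTo, ha]
  linear_combination (1 / √(N : ℝ)) * (key k.1 k.2 + key k.2 k.1)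

theorem sum_restrictTo_sq {N : ℕ} (T : Finset (Fin N)) {x : Fin N → ℝ} (hx : ∀ i, x i ^ 2 = 1) :
    ∑ i, restrictTo T x i ^ 2 = T.card := by
  simp [restrictTo, ite_pow, hx]

theorem signVec_sq {N : ℕ} (P : Finset (Fin N)) (i : Fin N) : signVec P i ^ 2 = 1 := by
  unfold signVec; split_ifs <;> norm_num

/-! ### Union bounds and uniform control of stability sums -/

theorem measureReal_exists_le {X ι : Type*} [MeasurableSpace X] (μ : Measure X) [IsFiniteMeasure μ]
    (s : Finset ι) (P : ι → X → Prop) :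
    μ.real {x | ∃ i ∈ s, P i x} ≤ ∑ i ∈ s, μ.real {x | P i x} := by
  have : {x | ∃ i ∈ s, P i x} = ⋃ i ∈ s, {x | P i x} := by ext; simp
  rw [this]
  exact measureReal_biUnion_finset_le s _

/-- The sum is `(1 + t)^N`. It controls the entropy in union bounds whose terms decay geometrically
in the number of sites. -/
theorem sum_pow_card_le {N : ℕ} {t : ℝ} (ht : 0 ≤ t) :
    ∑ J : Finset (Fin N), t ^ J.card ≤ Real.exp (t * N) := by
  have h := Finset.sum_pow_mul_eq_add_pow t 1 (Finset.univ : Finset (Fin N))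
  simp only [one_pow, mul_one, Finset.powerset_univ, Finset.card_univ, Fintype.card_fin] at h
  rw [h, mul_comm, Real.exp_nat_mul]
  exact pow_le_pow_left₀ (by positivity) (Real.add_one_le_exp t) N

theorem sum_pow_card_disagree_le {N : ℕ} (σ : Cube N) {t : ℝ} (ht : 0 ≤ t) :
    ∑ σ' : Cube N, t ^ (disagree σ σ').card ≤ Real.exp (t * N) := by
  refine le_trans (le_of_eq ?_) (sum_pow_card_le ht)
  refine Fintype.sum_bijective (fun σ' => disagree σ σ') ⟨?_, ?_⟩ _ _ fun _ => rfl
  · intro σ₁ σ₂ h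
    ext1 i
    have h1 : i ∈ disagree σ σ₁ ↔ i ∈ disagree σ σ₂ := by simp only at h; rw [h]
    simp only [disagree, Finset.mem_filter, Finset.mem_univ, true_and] at h1
    rcases Int.units_eq_one_or (σ i) with h | h <;>
      rcases Int.units_eq_one_or (σ₁ i) with h' | h' <;>
      rcases Int.units_eq_one_or (σ₂ i) with h'' | h'' <;> simp_all
  · intro J
    classical
    refine ⟨fun i => if i ∈ J then -σ i else σ i, ?_⟩
    ext i
    simp only [disagree, Finset.mem_filter, Finset.mem_univ, true_and]
    split_ifs with h
    · simp [h]
    · simp [h]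

/-- The disorder with the coefficients outside `m` replaced by zero. -/
noncomputable def maskDisorder {N : ℕ} (m : Finset (Fin N × Fin N)) (g : Disorder N) : Disorder N :=
  fun k => if k ∈ m then g k else 0

theorem linForm_maskDisorder {N : ℕ} (m : Finset (Fin N × Fin N)) (v : Fin N × Fin N → ℝ)
    (g : Disorder N) : linForm v (maskDisorder m g) = linForm (fun k => if k ∈ m then v k else 0) g := by
  simp [linForm_apply, maskDisorder]

theorem maskDisorder_univ {N : ℕ} (g : Disorder N) : maskDisorder Finset.univ g = g := by
  ext; simp [maskDisorder]

/-- All partial sums of stabilities are of order `√(N |T|)`. -/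
def StabilitySumsBounded {N : ℕ} (g : Disorder N) : Prop :=
  ∀ (σ : Cube N) (T : Finset (Fin N)), |∑ i ∈ T, stability g σ i| ≤ 5 * √((N : ℝ) * T.card)

/-- Each sum has variance at most `4|T|`, so its tail `2 exp (-25N/8)` beats the `4^N` pairs `(σ,
T)`. A mask only lowers the variance; it is needed for the part of the disorder frozen in the chaos
estimate. -/
theorem law_not_stabilitySumsBounded_le {N : ℕ} (m : Finset (Fin N × Fin N)) :
    (law N).real {g | ¬ StabilitySumsBounded (maskDisorder m g)} ≤ 2 * Real.exp (-N) := by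
  classical
  have hsub : {g : Disorder N | ¬ StabilitySumsBounded (maskDisorder m g)} ⊆
      {g | ∃ σ ∈ (Finset.univ : Finset (Cube N)), ∃ T ∈ (Finset.univ : Finset (Finset (Fin N))),
        5 * √((N : ℝ) * T.card) < |∑ i ∈ T, stability (maskDisorder m g) σ i|} := by
    intro g hg
    simpa [StabilitySumsBounded] using hg
  have hone : ∀ (σ : Cube N) (T : Finset (Fin N)),
      (law N).real {g | 5 * √((N : ℝ) * T.card) < |∑ i ∈ T, stability (maskDisorder m g) σ i|} ≤
        2 * Real.exp (-(25 * N / 8)) := by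
    intro σ T
    rcases T.eq_empty_or_nonempty with rfl | hT
    · simp; positivity
    set v : Fin N × Fin N → ℝ := fun k =>
      if k ∈ m then formCoeff (restrictTo T (spinVec σ)) (spinVec σ) k else 0 with hv
    have hTc : (0 : ℝ) < T.card := by exact_mod_cast hT.card_pos
    have hN : (0 : ℝ) < N := by
      obtain ⟨i, -⟩ := hT
      exact_mod_cast i.pos
    have hV : ∑ k, v k ^ 2 ≤ 4 * T.card := by
      calc ∑ k, v k ^ 2
          ≤ ∑ k, formCoeff (restrictTo T (spinVec σ)) (spinVec σ) k ^ 2 := by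
            refine Finset.sum_le_sum fun k _ => ?_
            simp only [hv]
            split_ifs
            · exact le_rfl
            · rw [zero_pow two_ne_zero]; positivity
        _ ≤ _ := sum_formCoeff_sq_le _ _
        _ = 4 * T.card := by
            rw [sum_restrictTo_sq T (spinVec_sq σ)]
            simp only [spinVec_sq, Finset.sum_const, Finset.card_univ, Fintype.card_fin,
              nsmul_eq_mul, mul_one]
            field_simp
    have hV' : ∑ k, ((-1 : ℝ) • v) k ^ 2 ≤ 4 * T.card := by simpa using hV
    have hz : 0 ≤ 5 * √((N : ℝ) * T.card) := by positivity
    have hexp : -(5 * √((N : ℝ) * T.card)) ^ 2 / (2 * (4 * T.card)) = -(25 * N / 8) := by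
      rw [mul_pow, Real.sq_sqrt (by positivity)]
      field_simp
      norm_num
    have h1 := law_linForm_ge_le v hV (by positivity) hz
    have h2 := law_linForm_ge_le _ hV' (by positivity) hz
    rw [hexp] at h1 h2
    calc _ ≤ (law N).real ({g | 5 * √((N : ℝ) * T.card) ≤ linForm v g} ∪
          {g | 5 * √((N : ℝ) * T.card) ≤ linForm ((-1 : ℝ) • v) g}) := by
          refine measureReal_mono ?_
          intro g hg
          simp only [Set.mem_ofPred_eq, sum_stability_eq, linForm_maskDisorder] at hg
          rcases lt_abs.1 hg with h | h
          · exact Or.inl h.le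
          · right
            simp only [Set.mem_ofPred_eq, linForm_smul, neg_one_mul]
            exact h.le
      _ ≤ _ := measureReal_union_le _ _
      _ ≤ _ := by linarith
  calc (law N).real {g | ¬ StabilitySumsBounded (maskDisorder m g)} ≤ _ := measureReal_mono hsub
    _ ≤ ∑ σ : Cube N, ∑ T : Finset (Fin N), 2 * Real.exp (-(25 * N / 8)) := by
        refine (measureReal_exists_le _ _ _).trans (Finset.sum_le_sum fun σ _ => ?_)
        exact (measureReal_exists_le _ _ _).trans (Finset.sum_le_sum fun T _ => hone σ T)
    _ = 4 ^ N * (2 * Real.exp (-(25 * N / 8))) := by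
        have h4 : (4 : ℝ) ^ N = 2 ^ N * 2 ^ N := by rw [← mul_pow]; norm_num
        rw [h4]
        simp [Fintype.card_units_int, mul_assoc]
    _ ≤ Real.exp (2 * N) * (2 * Real.exp (-(25 * N / 8))) := by
        gcongr
        rw [mul_comm, Real.exp_nat_mul]
        refine pow_le_pow_left₀ (by norm_num) ?_ N
        have : Real.exp 2 = Real.exp 1 * Real.exp 1 := by rw [← Real.exp_add]; norm_num
        nlinarith [Real.exp_one_gt_d9]
    _ = 2 * Real.exp (-(9 / 8 * N)) := by
        rw [mul_left_comm, ← Real.exp_add]; ring_nf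
    _ ≤ 2 * Real.exp (-N) := by
        gcongr
        have : (0 : ℝ) ≤ N := Nat.cast_nonneg N
        linarith

/-! ### Exceptional events behind the overlap gap -/

/-- A sparse set of coordinates on which the disorder has an atypically large form. -/
def HasLargeSparseForm {N : ℕ} (γ η : ℝ) (g : Disorder N) : Prop :=
  ∃ J : Finset (Fin N), J.Nonempty ∧ (J.card : ℝ) ≤ η * N ∧ ∃ P ⊆ J, ∃ T ⊆ J,
    γ * J.card / 3 ≤ 2 * linForm (formCoeff (restrictTo T (signVec P))
      (restrictTo J (signVec P))) g

/-- The variance is at most `4|J|²/N`, so exceeding `γ|J|/6` costs `exp (-γ²N/288)` whatever the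
size of `J`. Against this stand at most `4^|J|` pairs `(P, T)` and, for small `η`, few sets `J` with
`|J| ≤ ηN`. -/
theorem exists_law_hasLargeSparseForm_le {γ : ℝ} (hγ : 0 < γ) :
    ∃ η : ℝ, 0 < η ∧ ∃ c : ℝ, 0 < c ∧ ∀ N : ℕ,
      (law N).real {g | HasLargeSparseForm γ η g} ≤ Real.exp (-c * N) := by
  classical
  -- The factor `exp (l (ηN - |J|)) ≥ 1` encodes the size constraint. The entropy `4 exp (-l)` and
  -- `l η` each take at most `γ²/1152`, together half of the available `γ²/288`.
  obtain ⟨l, hl0, hl⟩ : ∃ l : ℝ, 0 < l ∧ 4 * Real.exp (-l) ≤ γ ^ 2 / 1152 := by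
    have h1 : Filter.Tendsto (fun l : ℝ => 4 * Real.exp (-l)) Filter.atTop (nhds (4 * 0)) :=
      Real.tendsto_exp_neg_atTop_nhds_zero.const_mul 4
    rw [mul_zero] at h1
    exact ((Filter.eventually_gt_atTop 0).and
      (h1.eventually_le_const (by positivity : (0 : ℝ) < γ ^ 2 / 1152))).exists
  refine ⟨γ ^ 2 / (1152 * l), by positivity, γ ^ 2 / 576, by positivity, fun N => ?_⟩
  set η := γ ^ 2 / (1152 * l) with hη
  have hlη : l * η = γ ^ 2 / 1152 := by rw [hη]; field_simp
  have hone : ∀ J P T : Finset (Fin N), T ⊆ J →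
      (law N).real {g | J.Nonempty ∧ (J.card : ℝ) ≤ η * N ∧ γ * J.card / 3 ≤
        2 * linForm (formCoeff (restrictTo T (signVec P)) (restrictTo J (signVec P))) g} ≤
      Real.exp (l * (η * N - J.card) - γ ^ 2 * N / 288) := by
    intro J P T hTJ
    by_cases hJ : J.Nonempty ∧ (J.card : ℝ) ≤ η * N
    swap
    · have : {g : Disorder N | J.Nonempty ∧ (J.card : ℝ) ≤ η * N ∧ γ * J.card / 3 ≤
          2 * linForm (formCoeff (restrictTo T (signVec P)) (restrictTo J (signVec P))) g} = ∅ := by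
        ext g; simp only [Set.mem_ofPred_eq, Set.mem_empty_iff_false, iff_false]; tauto
      rw [this]; simp; positivity
    obtain ⟨hJ, hJη⟩ := hJ
    have hJc : (0 : ℝ) < J.card := by exact_mod_cast hJ.card_pos
    have hN : (0 : ℝ) < N := by obtain ⟨i, -⟩ := hJ; exact_mod_cast i.pos
    have hV : ∑ k, formCoeff (restrictTo T (signVec P)) (restrictTo J (signVec P)) k ^ 2 ≤
        4 / N * (J.card : ℝ) ^ 2 := by
      refine (sum_formCoeff_sq_le _ _).trans ?_
      rw [sum_restrictTo_sq T (signVec_sq P), sum_restrictTo_sq J (signVec_sq P), sq]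
      have : (T.card : ℝ) ≤ J.card := by exact_mod_cast Finset.card_le_card hTJ
      gcongr
    have h1 := law_linForm_ge_le _ hV (by positivity)
      (by positivity : (0 : ℝ) ≤ γ * J.card / 6)
    have h2 : -(γ * J.card / 6) ^ 2 / (2 * (4 / N * (J.card : ℝ) ^ 2)) = -(γ ^ 2 * N / 288) := by
      field_simp; norm_num
    rw [h2] at h1
    refine (measureReal_mono ?_).trans (h1.trans ?_)
    · rintro g ⟨-, -, hg⟩
      simp only [Set.mem_ofPred_eq]; linarith
    · rw [Real.exp_le_exp]
      nlinarith [mul_nonneg hl0.le (sub_nonneg.2 hJη)]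
  have hsub : {g : Disorder N | HasLargeSparseForm γ η g} ⊆
      {g | ∃ J ∈ (Finset.univ : Finset (Finset (Fin N))), ∃ P ∈ J.powerset, ∃ T ∈ J.powerset,
        J.Nonempty ∧ (J.card : ℝ) ≤ η * N ∧ γ * J.card / 3 ≤
        2 * linForm (formCoeff (restrictTo T (signVec P)) (restrictTo J (signVec P))) g} := by
    rintro g ⟨J, hJ, hJη, P, hP, T, hT, h⟩
    exact ⟨J, Finset.mem_univ _, P, Finset.mem_powerset.2 hP, T, Finset.mem_powerset.2 hT, hJ, hJη, h⟩
  calc (law N).real {g | HasLargeSparseForm γ η g} ≤ _ := measureReal_mono hsub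
    _ ≤ ∑ J : Finset (Fin N), ∑ P ∈ J.powerset, ∑ T ∈ J.powerset,
          Real.exp (l * (η * N - J.card) - γ ^ 2 * N / 288) := by
        refine (measureReal_exists_le _ _ _).trans (Finset.sum_le_sum fun J _ => ?_)
        refine (measureReal_exists_le _ _ _).trans (Finset.sum_le_sum fun P _ => ?_)
        refine (measureReal_exists_le _ _ _).trans (Finset.sum_le_sum fun T hT => ?_)
        exact hone J P T (Finset.mem_powerset.1 hT)
    _ = Real.exp (l * η * N - γ ^ 2 * N / 288) *
          ∑ J : Finset (Fin N), (4 * Real.exp (-l)) ^ J.card := by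
        rw [Finset.mul_sum]
        refine Finset.sum_congr rfl fun J _ => ?_
        simp only [Finset.sum_const, Finset.card_powerset, nsmul_eq_mul, Nat.cast_pow,
          Nat.cast_ofNat]
        rw [mul_pow, ← Real.exp_nat_mul, ← mul_assoc, ← mul_pow, mul_left_comm, ← Real.exp_add]
        norm_num
        ring
    _ ≤ Real.exp (l * η * N - γ ^ 2 * N / 288) * Real.exp (4 * Real.exp (-l) * N) := by
        gcongr
        exact sum_pow_card_le (by positivity)
    _ ≤ Real.exp (-(γ ^ 2 / 576) * N) := by
        rw [← Real.exp_add, Real.exp_le_exp, hlη]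
        have : 4 * Real.exp (-l) * N ≤ γ ^ 2 / 1152 * N := by gcongr
        linarith

/-- A configuration `σ'` at distance at least `a N` from `σ` at which the fresh disorder has
atypically large stabilities on a part of the set of disagreement. -/
def HasLargeFreshField {N : ℕ} (γ a q : ℝ) (σ : Cube N) (g : Disorder N) : Prop :=
  ∃ σ' : Cube N, a * N ≤ (disagree σ σ').card ∧ ∃ T ⊆ disagree σ σ',
    γ * (disagree σ σ').card / 3 ≤ q * ∑ i ∈ T, stability g σ' i

/-- With `k` disagreements the variance is at most `8k/W` and the tail `exp (-2βk)`, where `β =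
γ²W/288`. Half of the exponent, through `k ≥ aN`, gives the decay `exp (-βaN)`; the other half pays
for the union over `σ'` and `T`. -/
theorem law_hasLargeFreshField_le {N : ℕ} {γ a q W : ℝ} (hγ : 0 < γ) (ha : 0 < a) (hW : 0 < W)
    (hq : q ^ 2 ≤ 2 / W) (hN : 0 < N) (σ : Cube N) :
    (law N).real {g | HasLargeFreshField γ a q σ g} ≤
      Real.exp (-(γ ^ 2 * W * a / 288 - 2 * Real.exp (-(γ ^ 2 * W / 288))) * N) := by
  classical
  have hN' : (0 : ℝ) < N := by exact_mod_cast hN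
  set β := γ ^ 2 * W / 288 with hβ
  have hβ0 : 0 < β := by positivity
  have hone : ∀ (σ' : Cube N), ∀ T ⊆ disagree σ σ',
      (law N).real {g | a * N ≤ (disagree σ σ').card ∧ γ * (disagree σ σ').card / 3 ≤
        q * ∑ i ∈ T, stability g σ' i} ≤ Real.exp (-β * (a * N) - β * (disagree σ σ').card) := by
    intro σ' T hT
    by_cases hJ : a * N ≤ (disagree σ σ').card
    swap
    · have : {g | a * N ≤ (disagree σ σ').card ∧ γ * (disagree σ σ').card / 3 ≤
        q * ∑ i ∈ T, stability g σ' i} = ∅ := by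
        ext g; simp only [Set.mem_ofPred_eq, Set.mem_empty_iff_false, iff_false]; tauto
      rw [this]; simp; positivity
    set k : ℝ := ((disagree σ σ').card : ℝ) with hk
    have hk0 : 0 < k := lt_of_lt_of_le (by positivity) hJ
    have hV : ∑ k, (q • formCoeff (restrictTo T (spinVec σ')) (spinVec σ')) k ^ 2 ≤ 8 * k / W := by
      simp only [Pi.smul_apply, smul_eq_mul, mul_pow, ← Finset.mul_sum]
      have h1 : ∑ k, formCoeff (restrictTo T (spinVec σ')) (spinVec σ') k ^ 2 ≤ 4 * k := by
        refine (sum_formCoeff_sq_le _ _).trans ?_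
        rw [sum_restrictTo_sq T (spinVec_sq σ')]
        simp only [spinVec_sq, Finset.sum_const, Finset.card_univ, Fintype.card_fin,
              nsmul_eq_mul, mul_one]
        have : (T.card : ℝ) ≤ k := by rw [hk]; exact_mod_cast Finset.card_le_card hT
        calc 4 / (N : ℝ) * (T.card * N) = 4 * T.card := by field_simp
          _ ≤ _ := by linarith
      calc _ ≤ 2 / W * (4 * k) := by gcongr
        _ = _ := by ring
    have h1 := law_linForm_ge_le _ hV (by positivity) (by positivity : (0 : ℝ) ≤ γ * k / 3)
    have h2 : -(γ * k / 3) ^ 2 / (2 * (8 * k / W)) = -(2 * β * k) := by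
      rw [hβ]; field_simp; norm_num
    rw [h2] at h1
    refine (measureReal_mono ?_).trans (h1.trans ?_)
    · rintro g ⟨-, hg⟩
      rw [sum_stability_eq, ← linForm_smul] at hg
      exact hg
    · rw [Real.exp_le_exp]
      nlinarith
  have hsub : {g : Disorder N | HasLargeFreshField γ a q σ g} ⊆
      {g | ∃ σ' ∈ (Finset.univ : Finset (Cube N)), ∃ T ∈ (disagree σ σ').powerset,
        a * N ≤ (disagree σ σ').card ∧ γ * (disagree σ σ').card / 3 ≤
        q * ∑ i ∈ T, stability g σ' i} := by
    rintro g ⟨σ', h1, T, hT, h2⟩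
    exact ⟨σ', Finset.mem_univ _, T, Finset.mem_powerset.2 hT, h1, h2⟩
  calc (law N).real {g | HasLargeFreshField γ a q σ g} ≤ _ := measureReal_mono hsub
    _ ≤ ∑ σ' : Cube N, ∑ T ∈ (disagree σ σ').powerset,
          Real.exp (-β * (a * N) - β * (disagree σ σ').card) := by
        refine (measureReal_exists_le _ _ _).trans (Finset.sum_le_sum fun σ' _ => ?_)
        refine (measureReal_exists_le _ _ _).trans (Finset.sum_le_sum fun T hT => ?_)
        exact hone σ' T (Finset.mem_powerset.1 hT)
    _ = Real.exp (-β * (a * N)) * ∑ σ' : Cube N, (2 * Real.exp (-β)) ^ (disagree σ σ').card := by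
        rw [Finset.mul_sum]
        refine Finset.sum_congr rfl fun σ' _ => ?_
        simp only [Finset.sum_const, Finset.card_powerset, nsmul_eq_mul, Nat.cast_pow,
          Nat.cast_ofNat]
        rw [mul_pow, ← Real.exp_nat_mul,
          mul_left_comm (Real.exp (-β * (a * N))), ← Real.exp_add]
        ring_nf
    _ ≤ Real.exp (-β * (a * N)) * Real.exp (2 * Real.exp (-β) * N) := by
        gcongr
        exact sum_pow_card_disagree_le σ (by positivity)
    _ = _ := by
        rw [← Real.exp_add, hβ]; ring_nf

/-! ### Measurability and independence of the fresh disorder -/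

theorem measurableSet_mem_of_finite {X ι : Type*} [MeasurableSpace X] [Finite ι]
    [MeasurableSpace ι] [MeasurableSingletonClass ι] {F : X → ι} (hF : Measurable F)
    {Q : ι → Set X} (hQ : ∀ i, MeasurableSet (Q i)) : MeasurableSet {x | x ∈ Q (F x)} := by
  have : {x | x ∈ Q (F x)} = ⋃ i, (F ⁻¹' {i} ∩ Q i) := by
    ext x; simp
  rw [this]
  exact MeasurableSet.iUnion fun i => (hF (measurableSet_singleton i)).inter (hQ i)

theorem measurable_stability {N : ℕ} (σ : Cube N) (i : Fin N) :
    Measurable fun g : Disorder N => stability g σ i := by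
  simp_rw [stability_eq_linForm]
  fun_prop

theorem measurableSet_mem_gappedStates {N : ℕ} (γ δ : ℝ) (σ : Cube N) :
    MeasurableSet {g : Disorder N | σ ∈ gappedStates γ δ g} := by
  have h : ∀ g : Disorder N,
      (((Finset.univ.filter fun i => spinVec σ i * localField g σ i < γ).card : ℕ) : ℝ) =
      ∑ i, Set.indicator {g : Disorder N | stability g σ i < γ} (fun _ => (1 : ℝ)) g := by
    intro g
    simp [Set.indicator_apply, stability]
  simp only [gappedStates, Set.mem_ofPred_eq, h]
  refine measurableSet_le ?_ measurable_const
  refine Finset.measurable_sum _ fun i _ => ?_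
  exact measurable_const.indicator (measurableSet_lt (measurable_stability σ i) measurable_const)

theorem measurableSet_hasLargeFreshField {N : ℕ} (γ a q : ℝ) (σ : Cube N) :
    MeasurableSet {g : Disorder N | HasLargeFreshField γ a q σ g} := by
  have : {g : Disorder N | HasLargeFreshField γ a q σ g} =
      ⋃ σ' : Cube N, ⋃ T : Finset (Fin N), ({_g | a * N ≤ (disagree σ σ').card ∧
        T ⊆ disagree σ σ'} ∩
        {g | γ * (disagree σ σ').card / 3 ≤ q * ∑ i ∈ T, stability g σ' i}) := by
    ext g
    simp only [HasLargeFreshField, Set.mem_ofPred_eq, Set.mem_iUnion, Set.mem_inter_iff]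
    exact ⟨fun ⟨σ', h1, T, hT, h2⟩ => ⟨σ', T, ⟨h1, hT⟩, h2⟩,
      fun ⟨σ', T, ⟨h1, hT⟩, h2⟩ => ⟨σ', h1, T, hT, h2⟩⟩
  rw [this]
  refine MeasurableSet.iUnion fun σ' => MeasurableSet.iUnion fun T => ?_
  refine (MeasurableSet.const _).inter (measurableSet_le measurable_const ?_)
  exact (Finset.measurable_sum _ fun i _ => measurable_stability σ' i).const_mul q

theorem prod_real_le_of_section_le {X Y : Type*} [MeasurableSpace X] [MeasurableSpace Y]
    (μ : Measure X) [IsProbabilityMeasure μ] (ν : Measure Y) [IsProbabilityMeasure ν]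
    {S : Set (X × Y)} (hS : MeasurableSet S) {b : ℝ} (hb0 : 0 ≤ b)
    (hb : ∀ x, ν.real (Prod.mk x ⁻¹' S) ≤ b) : (μ.prod ν).real S ≤ b := by
  rw [measureReal_def, Measure.prod_apply hS]
  refine ENNReal.toReal_le_of_le_ofReal hb0 ?_
  calc ∫⁻ x, ν (Prod.mk x ⁻¹' S) ∂μ ≤ ∫⁻ _, ENNReal.ofReal b ∂μ := by
        refine lintegral_mono fun x => ?_
        rw [← ofReal_measureReal]
        exact ENNReal.ofReal_le_ofReal (hb x)
    _ = ENNReal.ofReal b := by simp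

theorem measurePreserving_prod_right_comm {X Y Z : Type*} [MeasurableSpace X] [MeasurableSpace Y]
    [MeasurableSpace Z] (μ : Measure X) (ν : Measure Y) (ρ : Measure Z) [SFinite μ] [SFinite ν]
    [SFinite ρ] : MeasurePreserving (fun x : (X × Y) × Z => ((x.1.1, x.2), x.1.2))
      ((μ.prod ν).prod ρ) ((μ.prod ρ).prod ν) :=
  ((measurePreserving_prodAssoc μ ρ ν).symm _).comp
    (((MeasurePreserving.id μ).prod Measure.measurePreserving_swap).comp
      (measurePreserving_prodAssoc μ ν ρ))

/-- If an event about a fresh variable has probability at most `b` for every value of a finite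
parameter, then it does so when the parameter is a function of independent variables. -/
theorem prod_prod_real_mem_le {X Y Z ι : Type*} [MeasurableSpace X] [MeasurableSpace Y]
    [MeasurableSpace Z] [Finite ι] [MeasurableSpace ι] [MeasurableSingletonClass ι]
    (μ : Measure X) [IsProbabilityMeasure μ] (ν : Measure Y) [IsProbabilityMeasure ν]
    (ρ : Measure Z) [IsProbabilityMeasure ρ] {F : X × Z → ι} (hF : Measurable F) {Q : ι → Set Y}
    (hQ : ∀ i, MeasurableSet (Q i)) {b : ℝ} (hb0 : 0 ≤ b) (hb : ∀ i, ν.real (Q i) ≤ b) :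
    ((μ.prod ν).prod ρ).real {z | z.1.2 ∈ Q (F (z.1.1, z.2))} ≤ b := by
  have hm : MeasurableSet {z : (X × Z) × Y | z.2 ∈ Q (F z.1)} :=
    measurableSet_mem_of_finite (Q := fun i => Prod.snd ⁻¹' Q i) (hF.comp measurable_fst)
      fun i => measurable_snd (hQ i)
  have h := prod_real_le_of_section_le (μ.prod ρ) ν hm hb0 fun x => hb (F x)
  rwa [measureReal_def, ← (measurePreserving_prod_right_comm μ ν ρ).measure_preimage
    hm.nullMeasurableSet] at h

theorem measurePreserving_correlatedLaw_prod {N : ℕ} {Ω : Type*} [MeasurableSpace Ω] (ν : Measure Ω)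
    [IsProbabilityMeasure ν] (p : ℝ) :
    MeasurePreserving (fun x : (Disorder N × Disorder N) × Ω =>
      ((x.1.1, p • x.1.1 + √(1 - p ^ 2) • x.1.2), x.2)) (((law N).prod (law N)).prod ν)
      ((correlatedLaw N p).prod ν) := by
  have h : MeasurePreserving (fun x : Disorder N × Disorder N =>
      (x.1, p • x.1 + √(1 - p ^ 2) • x.2)) ((law N).prod (law N)) (correlatedLaw N p) :=
    ⟨by fun_prop, rfl⟩
  exact h.prod (MeasurePreserving.id ν)

instance (N : ℕ) (p : ℝ) : IsProbabilityMeasure (correlatedLaw N p) := by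
  unfold correlatedLaw
  exact Measure.isProbabilityMeasure_map (by fun_prop)

/-! ### The overlap gap -/

theorem card_unstable_le {N : ℕ} {γ δ : ℝ} {g : Disorder N} {σ : Cube N}
    (h : σ ∈ gappedStates γ δ g) :
    ((Finset.univ.filter fun i => stability g σ i < γ).card : ℝ) ≤ δ * N := h

/-- Outside the exceptional events, no gapped states of two strongly correlated Hamiltonians are at
an intermediate distance. -/
theorem not_gapped_of_intermediate {N : ℕ} {γ δ η a W p q : ℝ} (hγ : 0 < γ) (hN : 0 < N)
    (ha : 0 < a) (hδ : 4 * δ ≤ a) (hp : p ≤ 1) (hpW : 1 - p ≤ 1 / W) (hW : 0 < W)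
    (haW : 225 ≤ γ ^ 2 * W ^ 2 * a) {g h : Disorder N} (hsparse : ¬ HasLargeSparseForm γ η g)
    (hbdd : StabilitySumsBounded g) {σ σ' : Cube N} (hfresh : ¬ HasLargeFreshField γ a q σ h)
    (hσ : σ ∈ gappedStates γ δ g) (hσ' : σ' ∈ gappedStates γ δ (p • g + q • h))
    (hlow : a * N ≤ (disagree σ σ').card) : η * N < (disagree σ σ').card := by
  by_contra! hup
  have hN' : (0 : ℝ) < N := by exact_mod_cast hN
  set J := disagree σ σ' with hJ
  set B := Finset.univ.filter fun i => stability g σ i < γ with hB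
  set B' := Finset.univ.filter fun i => stability (p • g + q • h) σ' i < γ with hB'
  have hBc : (B.card : ℝ) ≤ δ * N := card_unstable_le hσ
  have hBc' : (B'.card : ℝ) ≤ δ * N := card_unstable_le hσ'
  -- At most `2δN ≤ aN/2 ≤ |J|/2` sites are removed, so `|T| ≥ |J|/2` and the stabilities over `T`
  -- sum to at least `γ|J|`.
  set T := J \ (B ∪ B') with hT
  have hTJ : T ⊆ J := Finset.sdiff_subset
  have hk0 : (0 : ℝ) < J.card := lt_of_lt_of_le (by positivity) hlow
  have hTc : (J.card : ℝ) ≤ 2 * T.card := by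
    have h1 : J.card ≤ T.card + (B.card + B'.card) := by
      have h2 := Finset.le_card_sdiff (B ∪ B') J
      rw [← hT] at h2
      have h3 := Finset.card_union_le B B'
      omega
    have h2 : (J.card : ℝ) ≤ T.card + (B.card + B'.card) := by exact_mod_cast h1
    have h3 : 4 * δ * N ≤ a * N := by gcongr
    linarith
  have hsum : 2 * γ * T.card ≤
      ∑ i ∈ T, (stability g σ i + stability (p • g + q • h) σ' i) := by
    have : ∀ i ∈ T, 2 * γ ≤ stability g σ i + stability (p • g + q • h) σ' i := by
      intro i hi
      simp only [hT, hB, hB', Finset.mem_sdiff, Finset.mem_union, Finset.mem_filter,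
        Finset.mem_univ, true_and, not_or, not_lt] at hi
      linarith [hi.2.1, hi.2.2]
    have h1 := Finset.card_nsmul_le_sum T _ _ this
    rw [nsmul_eq_mul] at h1
    linarith
  obtain ⟨P, hP, hPs⟩ := sum_stability_add_stability g σ σ' hTJ
  -- Three terms: the form on `J × J`, the loss of correlation, and the fresh field. Each is at most
  -- `γ|J|/3`, the first and last strictly, contradicting the lower bound `γ|J|`.
  have hdecomp : ∑ i ∈ T, (stability g σ i + stability (p • g + q • h) σ' i) =
      ∑ i ∈ T, (stability g σ i + stability g σ' i) - (1 - p) * ∑ i ∈ T, stability g σ' i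
        + q * ∑ i ∈ T, stability h σ' i := by
    rw [Finset.mul_sum, Finset.mul_sum, ← Finset.sum_sub_distrib, ← Finset.sum_add_distrib]
    refine Finset.sum_congr rfl fun i _ => ?_
    rw [stability_add_smul]; ring
  have h1 : ∑ i ∈ T, (stability g σ i + stability g σ' i) < γ * J.card / 3 := by
    rw [hPs]
    by_contra! hcon
    exact hsparse ⟨J, Finset.card_pos.1 (by exact_mod_cast hk0), hup, P, hP, T, hTJ, hcon⟩
  have h3 : q * ∑ i ∈ T, stability h σ' i < γ * J.card / 3 := by
    by_contra! hcon
    exact hfresh ⟨σ', hlow, T, hTJ, hcon⟩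
  have h2 : -((1 - p) * ∑ i ∈ T, stability g σ' i) ≤ γ * J.card / 3 := by
    have h4 := (neg_le_abs _).trans (hbdd σ' T)
    -- The hypothesis with `225 = 15²` and `aN ≤ |J|` give this bound, so that `5√(N|T|)/W ≤
    -- γ|J|/3`.
    have h5 : √((N : ℝ) * T.card) ≤ γ * W * J.card / 15 := by
      refine Real.sqrt_le_iff.2 ⟨by positivity, ?_⟩
      have h6 : (T.card : ℝ) ≤ J.card := by exact_mod_cast Finset.card_le_card hTJ
      calc (N : ℝ) * T.card ≤ N * J.card := by gcongr
        _ ≤ (γ ^ 2 * W ^ 2 * a / 225) * N * J.card := by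
            have : 1 ≤ γ ^ 2 * W ^ 2 * a / 225 := by linarith
            have h7 : 0 ≤ (N : ℝ) * J.card := by positivity
            nlinarith
        _ = (γ ^ 2 * W ^ 2 / 225) * (a * N) * J.card := by ring
        _ ≤ (γ ^ 2 * W ^ 2 / 225) * J.card * J.card := by gcongr
        _ = _ := by ring
    calc -((1 - p) * ∑ i ∈ T, stability g σ' i) = (1 - p) * -∑ i ∈ T, stability g σ' i := by ring
      _ ≤ (1 - p) * (5 * √((N : ℝ) * T.card)) := by
          have : 0 ≤ 1 - p := by linarith
          gcongr
      _ ≤ 1 / W * (5 * (γ * W * J.card / 15)) := by gcongr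
      _ = _ := by field_simp; norm_num
  nlinarith

/-- The event that the output on the first Hamiltonian and some state are gapped for the respective
Hamiltonians and at an intermediate distance. -/
def intermediateGapped {N : ℕ} {Ω : Type*} (F : Disorder N × Ω → Cube N) (γ δ a η : ℝ) :
    Set ((Disorder N × Disorder N) × Ω) :=
  {x | F (x.1.1, x.2) ∈ gappedStates γ δ x.1.1 ∧
      ∃ σ' ∈ gappedStates γ δ x.1.2, a * N ≤ (disagree (F (x.1.1, x.2)) σ').card ∧
        (disagree (F (x.1.1, x.2)) σ').card ≤ η * N}

/-- The pair is written through independent `g` and `h`. The output depends on `g` and the seed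
only, so it is independent of `h`, and the fresh-field bound for a fixed `σ` applies to it. -/
theorem correlatedLaw_intermediateGapped_le {N : ℕ} {Ω : Type*} [MeasurableSpace Ω] (ν : Measure Ω)
    [IsProbabilityMeasure ν] {F : Disorder N × Ω → Cube N} (hF : Measurable F)
    {γ δ η a W p b₁ b₃ : ℝ} (hγ : 0 < γ) (hN : 0 < N)
    (ha : 0 < a) (hδ : 4 * δ ≤ a) (hp : p ≤ 1) (hpW : 1 - p ≤ 1 / W) (hW : 0 < W)
    (haW : 225 ≤ γ ^ 2 * W ^ 2 * a)
    (hb₁ : (law N).real {g | HasLargeSparseForm γ η g} ≤ b₁)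
    (hb₃ : ∀ σ, (law N).real {g | HasLargeFreshField γ a (√(1 - p ^ 2)) σ g} ≤ b₃) :
    ((correlatedLaw N p).prod ν).real (intermediateGapped F γ δ a η) ≤
      b₁ + 2 * Real.exp (-N) + b₃ := by
  have hSm : MeasurableSet (intermediateGapped F γ δ a η) := by
    have hF' : Measurable fun x : (Disorder N × Disorder N) × Ω => F (x.1.1, x.2) := by fun_prop
    refine measurableSet_mem_of_finite (Q := fun σ => {x | σ ∈ gappedStates γ δ x.1.1 ∧
      ∃ σ' ∈ gappedStates γ δ x.1.2, a * N ≤ (disagree σ σ').card ∧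
        (disagree σ σ').card ≤ η * N}) hF' fun σ => ?_
    refine MeasurableSet.inter ?_ ?_
    · exact (measurable_fst.comp measurable_fst) (measurableSet_mem_gappedStates γ δ σ)
    · have : {x : (Disorder N × Disorder N) × Ω | ∃ σ' ∈ gappedStates γ δ x.1.2,
          a * N ≤ (disagree σ σ').card ∧ (disagree σ σ').card ≤ η * N} =
          ⋃ σ' : Cube N, ({x | σ' ∈ gappedStates γ δ x.1.2} ∩
            {_x | a * N ≤ (disagree σ σ').card ∧ (disagree σ σ').card ≤ η * N}) := by
        ext x; simp
      change MeasurableSet {x : (Disorder N × Disorder N) × Ω | ∃ σ' ∈ gappedStates γ δ x.1.2,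
          a * N ≤ (disagree σ σ').card ∧ (disagree σ σ').card ≤ η * N}
      rw [this]
      exact MeasurableSet.iUnion fun σ' => ((measurable_snd.comp measurable_fst)
        (measurableSet_mem_gappedStates γ δ σ')).inter (MeasurableSet.const _)
  rw [measureReal_def, ← (measurePreserving_correlatedLaw_prod ν p).measure_preimage hSm.nullMeasurableSet,
    ← measureReal_def]
  set q := √(1 - p ^ 2) with hq
  have hfst : MeasurePreserving (fun x : (Disorder N × Disorder N) × Ω => x.1.1)
      (((law N).prod (law N)).prod ν) (law N) := measurePreserving_fst.comp measurePreserving_fst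
  have hfst_le : ∀ s : Set (Disorder N), (((law N).prod (law N)).prod ν).real
      ((fun x : (Disorder N × Disorder N) × Ω => x.1.1) ⁻¹' s) ≤ (law N).real s := by
    intro s
    rw [measureReal_def, measureReal_def]
    refine ENNReal.toReal_mono (measure_ne_top _ _) ?_
    conv_rhs => rw [← hfst.map_eq]
    exact Measure.le_map_apply hfst.aemeasurable s
  calc _ ≤ (((law N).prod (law N)).prod ν).real
        (((fun x : (Disorder N × Disorder N) × Ω => x.1.1) ⁻¹' {g | HasLargeSparseForm γ η g} ∪
          (fun x : (Disorder N × Disorder N) × Ω => x.1.1) ⁻¹'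
            {g | ¬ StabilitySumsBounded (maskDisorder Finset.univ g)}) ∪
          {x | x.1.2 ∈ {h | HasLargeFreshField γ a q (F (x.1.1, x.2)) h}}) := by
        refine measureReal_mono ?_
        rintro ⟨⟨g, h⟩, ω⟩ ⟨hσ, σ', hσ', hlow, hup⟩
        by_contra hcon
        simp only [Set.mem_union, Set.mem_preimage, Set.mem_ofPred_eq, not_or, not_not,
          maskDisorder_univ] at hcon
        obtain ⟨⟨h1, h2⟩, h3⟩ := hcon
        exact absurd (not_gapped_of_intermediate hγ hN ha hδ hp hpW hW haW h1 h2 h3 hσ hσ' hlow)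
          (not_lt.2 hup)
    _ ≤ _ := measureReal_union_le _ _
    _ ≤ _ := by
        refine add_le_add ((measureReal_union_le _ _).trans (add_le_add ?_ ?_)) ?_
        · exact (hfst_le _).trans hb₁
        · exact (hfst_le _).trans (law_not_stabilitySumsBounded_le _)
        · exact prod_prod_real_mem_le (law N) (law N) ν hF
            (measurableSet_hasLargeFreshField γ a q) (measureReal_nonneg.trans (hb₃ 1)) hb₃

/-! ### Chaos: gapped states far from a decorrelated output -/

/-- The positions `(i, j)` with `i` in the first and `j` in the second half of the sites. -/
def cornerBlock (N : ℕ) : Finset (Fin N × Fin N) :=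
  Finset.univ.filter fun k => k.1.val < N / 2 ∧ N / 2 ≤ k.2.val

/-- The disorder equal to `x.1` on `m` and to `x.2` elsewhere. -/
noncomputable def splice {N : ℕ} (m : Finset (Fin N × Fin N)) (x : Disorder N × Disorder N) :
    Disorder N := fun k => if k ∈ m then x.1 k else x.2 k

theorem splice_eq {N : ℕ} (m : Finset (Fin N × Fin N)) (x : Disorder N × Disorder N) :
    splice m x = maskDisorder m x.1 + maskDisorder mᶜ x.2 := by
  ext k
  by_cases h : k ∈ m <;> simp [splice, maskDisorder, h]

theorem measurable_splice {N : ℕ} (m : Finset (Fin N × Fin N)) :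
    Measurable (splice (N := N) m) := by
  refine measurable_pi_lambda _ fun k => ?_
  unfold splice
  split_ifs <;> fun_prop

theorem measurePreserving_splice {N : ℕ} (m : Finset (Fin N × Fin N)) :
    MeasurePreserving (splice m) ((law N).prod (law N)) (law N) := by
  refine ⟨measurable_splice m, ?_⟩
  conv_rhs => unfold law
  refine (Measure.pi_eq fun s hs => ?_).symm
  rw [Measure.map_apply (measurable_splice m) (MeasurableSet.univ_pi hs)]
  have hpre : splice m ⁻¹' Set.univ.pi s =
      (Set.univ.pi fun k => if k ∈ m then s k else Set.univ) ×ˢ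
        (Set.univ.pi fun k => if k ∈ m then Set.univ else s k) := by
    ext x
    simp only [Set.mem_preimage, Set.mem_pi, Set.mem_univ, true_implies, Set.mem_prod, splice]
    rw [← forall_and]
    refine forall_congr' fun k => ?_
    by_cases h : k ∈ m <;> simp [h]
  rw [hpre, Measure.prod_prod, law, Measure.pi_pi, Measure.pi_pi, ← Finset.prod_mul_distrib]
  refine Finset.prod_congr rfl fun k _ => ?_
  by_cases h : k ∈ m <;> simp [h]

/-- The coefficients of the contribution of the corner block to the stability of site `i`. -/
noncomputable def rowCoeff {N : ℕ} (σ : Cube N) (i : Fin N) (k : Fin N × Fin N) : ℝ :=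
  if k.1 = i ∧ k ∈ cornerBlock N then 1 / √(N : ℝ) * (spinVec σ k.1 * spinVec σ k.2) else 0

/-- A site of the first half enters the corner block only as a row index. Its contribution is
therefore one row sum, and distinct sites use disjoint, hence independent, rows. -/
theorem stability_maskDisorder_cornerBlock {N : ℕ} (x : Disorder N) (σ : Cube N) {i : Fin N}
    (hi : i.val < N / 2) :
    stability (maskDisorder (cornerBlock N) x) σ i = linForm (rowCoeff σ i) x := by
  rw [stability_eq_linForm, linForm_maskDisorder]
  congr 2
  ext ⟨a, b⟩
  by_cases hk : (a, b) ∈ cornerBlock N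
  · have hk' := hk
    simp only [cornerBlock, Finset.mem_filter, Finset.mem_univ, true_and] at hk'
    have hab : a ≠ b := by rintro rfl; omega
    have hbi : b ≠ i := by rintro rfl; omega
    by_cases hai : a = i
    · subst hai; simp [rowCoeff, hk, formCoeff, hab, hbi]
    · simp [rowCoeff, hk, formCoeff, hbi, hai]
  · simp [rowCoeff, hk]

theorem half_le_sum_rowCoeff_sq {N : ℕ} (σ : Cube N) {i : Fin N} (hi : i.val < N / 2) :
    1 / 2 ≤ ∑ k, rowCoeff σ i k ^ 2 := by
  have hN : (0 : ℝ) < N := by exact_mod_cast i.pos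
  have h1 : ∑ k, rowCoeff σ i k ^ 2 =
      ∑ b : Fin N, if N / 2 ≤ b.val then 1 / (N : ℝ) else 0 := by
    rw [Fintype.sum_prod_type, Finset.sum_eq_single i]
    · refine Finset.sum_congr rfl fun b _ => ?_
      by_cases hb : N / 2 ≤ b.val
      · simp [rowCoeff, cornerBlock, hi, hb, mul_pow, spinVec_sq, Real.sq_sqrt hN.le]
      · simp [rowCoeff, cornerBlock, hb]
    · intro a _ ha
      exact Finset.sum_eq_zero fun b _ => by simp [rowCoeff, ha]
    · simp
  have h2 : (Finset.univ.filter fun b : Fin N => N / 2 ≤ b.val).card = N - N / 2 := by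
    have h3 : (Finset.univ.filter fun b : Fin N => b.val < N / 2).card = min N (N / 2) :=
      Fin.card_filter_val_lt
    have h4 := Finset.card_filter_add_card_filter_not
      (s := (Finset.univ : Finset (Fin N))) (fun b : Fin N => b.val < N / 2)
    simp only [not_lt, Finset.card_univ, Fintype.card_fin] at h4
    omega
  rw [h1, ← Finset.sum_filter, Finset.sum_const, h2, nsmul_eq_mul, mul_one_div,
    div_le_div_iff₀ two_pos hN, one_mul]
  have : N ≤ (N - N / 2) * 2 := by omega
  exact_mod_cast this

theorem iIndepFun_linForm_rowCoeff {N : ℕ} (σ : Cube N) :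
    iIndepFun (fun i x => linForm (rowCoeff σ i) x) (law N) := by
  have h : HasGaussianLaw (fun x : Disorder N => (fun i => linForm (rowCoeff σ i) x)) (law N) :=
    (IsGaussian.hasGaussianLaw_id (μ := law N)).map_fun
      (ContinuousLinearMap.pi fun i => linForm (rowCoeff σ i))
  refine h.iIndepFun_of_covariance_eq_zero fun i j hij => ?_
  rw [covariance_linForm_law]
  refine Finset.sum_eq_zero fun k _ => ?_
  by_cases hi : k.1 = i
  · have : k.1 ≠ j := fun hj => hij (hi.symm.trans hj)
    simp [rowCoeff, this]
  · simp [rowCoeff, hi]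

/-- The lower tail of the standard Gaussian. -/
noncomputable def lowerTail (M : ℝ) : ℝ := (gaussianReal 0 1).real (Set.Iic (-(2 * M)))

theorem lowerTail_pos (M : ℝ) : 0 < lowerTail M := by
  rw [lowerTail, measureReal_def, ENNReal.toReal_pos_iff]
  refine ⟨pos_iff_ne_zero.2 fun h => ?_, measure_lt_top _ _⟩
  have := gaussianReal_absolutelyContinuous' 0 (one_ne_zero) h
  simp at this

theorem lowerTail_le {N : ℕ} {v : Fin N × Fin N → ℝ} (hv : 1 / 2 ≤ ∑ k, v k ^ 2) {M : ℝ}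
    (hM : 0 ≤ M) : lowerTail M ≤ (law N).real {x | linForm v x ≤ -M} := by
  set V := ∑ k, v k ^ 2 with hV
  have h1 : (law N).map (fun g => linForm v g) = (gaussianReal 0 1).map (√V * ·) := by
    rw [map_linForm_law, gaussianReal_map_const_mul]
    congr 1
    · simp
    · ext
      simp [Real.sq_sqrt (by linarith : 0 ≤ V), ← hV, (by linarith : 0 ≤ V)]
  have h2 : (law N) {x | linForm v x ≤ -M} = (gaussianReal 0 1) {z | √V * z ≤ -M} := by
    have h3 := congrArg (fun μ => μ (Set.Iic (-M))) h1
    rw [Measure.map_apply (by fun_prop) measurableSet_Iic,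
      Measure.map_apply (by fun_prop) measurableSet_Iic] at h3
    exact h3
  rw [measureReal_def, h2, ← measureReal_def, lowerTail]
  refine measureReal_mono fun z hz => ?_
  simp only [Set.mem_Iic, Set.mem_ofPred_eq] at hz ⊢
  -- This is the source of the factor `2` in `lowerTail`: `z ≤ -2M` and `√V ≥ 1/2` force `√V z ≤
  -- -M`.
  have h4 : 1 / 2 ≤ √V := Real.le_sqrt_of_sq_le (by norm_num; linarith)
  nlinarith

/-- Independent row sums: it is exponentially unlikely that only few of them are very negative. -/
theorem law_card_row_le {N : ℕ} (σ : Cube N) {G : Finset (Fin N)}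
    (hG : ∀ i ∈ G, i.val < N / 2) {M t : ℝ} (hM : 0 ≤ M) :
    (law N).real {x | ((G.filter fun i => linForm (rowCoeff σ i) x ≤ -M).card : ℝ) ≤ t} ≤
      Real.exp (t - lowerTail M / 2 * G.card) := by
  classical
  -- Each `f i` with `i ∈ G` is `exp (-1)` on a very negative row and `1` otherwise. Their product
  -- is `exp` of minus the count, so this is an exponential Markov bound with parameter `1`.
  set f : Fin N → ℝ → ℝ := fun i z =>
    if i ∈ G then Set.indicator (Set.Iic (-M)) (fun _ => Real.exp (-1) - 1) z + 1 else 1 with hf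
  have hfm : ∀ i, Measurable (f i) := by
    intro i
    by_cases hi : i ∈ G
    · simp only [hf, hi, if_true]
      exact (measurable_const.indicator measurableSet_Iic).add_const 1
    · simp only [hf, hi, if_false]; exact measurable_const
  have hf01 : ∀ i z, 0 < f i z ∧ f i z ≤ 1 := by
    intro i z
    have h1 := Real.exp_pos (-1)
    have h2 : Real.exp (-1) ≤ 1 := Real.exp_le_one_iff.2 (by norm_num)
    simp only [hf, Set.indicator_apply]
    split_ifs <;> constructor <;> linarith
  have hprod : ∀ x : Disorder N, ∏ i, f i (linForm (rowCoeff σ i) x) =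
      Real.exp (-((G.filter fun i => linForm (rowCoeff σ i) x ≤ -M).card : ℝ)) := by
    intro x
    have h1 : ∀ i, f i (linForm (rowCoeff σ i) x) =
        if i ∈ G.filter fun i => linForm (rowCoeff σ i) x ≤ -M then Real.exp (-1) else 1 := by
      intro i
      simp only [hf, Set.indicator_apply, Set.mem_Iic, Finset.mem_filter]
      split_ifs <;> simp_all
    simp_rw [h1]
    rw [Finset.prod_ite_mem, Finset.univ_inter, Finset.prod_const, ← Real.exp_nat_mul]
    simp
  have hm : ∀ i, Measurable fun x : Disorder N => linForm (rowCoeff σ i) x := fun i => by fun_prop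
  have hint : ∫ x, ∏ i, f i (linForm (rowCoeff σ i) x) ∂(law N) =
      ∏ i, ∫ x, f i (linForm (rowCoeff σ i) x) ∂(law N) :=
    (iIndepFun_linForm_rowCoeff σ).integral_fun_prod_comp (fun i => (hm i).aemeasurable)
      fun i => (hfm i).aestronglyMeasurable
  have hterm : ∀ i ∈ G, ∫ x, f i (linForm (rowCoeff σ i) x) ∂(law N) ≤
      Real.exp (-(lowerTail M / 2)) := by
    intro i hi
    have h1 : ∫ x, f i (linForm (rowCoeff σ i) x) ∂(law N) =
        (Real.exp (-1) - 1) * (law N).real {x | linForm (rowCoeff σ i) x ≤ -M} + 1 := by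
      have h2 : ∀ x : Disorder N, f i (linForm (rowCoeff σ i) x) =
          Set.indicator {x : Disorder N | linForm (rowCoeff σ i) x ≤ -M}
            (fun _ => Real.exp (-1) - 1) x + 1 := by
        intro x; simp [hf, hi, Set.indicator_apply]
      have h3 : MeasurableSet {x : Disorder N | linForm (rowCoeff σ i) x ≤ -M} :=
        measurableSet_le (hm i) measurable_const
      simp_rw [h2]
      rw [integral_add ((integrable_const _).indicator h3) (integrable_const _),
        integral_indicator_const _ h3]
      simp [mul_comm]
    have h4 := lowerTail_le (half_le_sum_rowCoeff_sq σ (hG i hi)) hM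
    have h5 : Real.exp (-1) ≤ 1 / 2 := by
      rw [Real.exp_neg, inv_le_comm₀ (Real.exp_pos _) (by norm_num)]
      have := Real.exp_one_gt_d9
      norm_num; linarith
    rw [h1]
    have h6 := Real.add_one_le_exp (-(lowerTail M / 2))
    nlinarith [lowerTail_pos M]
  have hsub : ∀ x : Disorder N,
      Set.indicator {x | ((G.filter fun i => linForm (rowCoeff σ i) x ≤ -M).card : ℝ) ≤ t}
        (fun _ => (1 : ℝ)) x ≤ Real.exp t * ∏ i, f i (linForm (rowCoeff σ i) x) := by
    intro x
    rw [hprod, ← Real.exp_add, Set.indicator_apply]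
    split_ifs with h
    · simp only [Set.mem_ofPred_eq] at h
      exact Real.one_le_exp (by linarith)
    · positivity
  have hsm : MeasurableSet {x : Disorder N |
      ((G.filter fun i => linForm (rowCoeff σ i) x ≤ -M).card : ℝ) ≤ t} := by
    have h1 : ∀ x : Disorder N,
        ((G.filter fun i => linForm (rowCoeff σ i) x ≤ -M).card : ℝ) =
        ∑ i ∈ G, Set.indicator {x : Disorder N | linForm (rowCoeff σ i) x ≤ -M}
          (fun _ => (1 : ℝ)) x := by
      intro x; simp [Set.indicator_apply]
    simp_rw [h1]
    exact measurableSet_le (Finset.measurable_sum _ fun i _ => measurable_const.indicator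
      (measurableSet_le (hm i) measurable_const)) measurable_const
  have hpint : Integrable (fun x => ∏ i, f i (linForm (rowCoeff σ i) x)) (law N) := by
    refine Integrable.of_bound (C := 1) (Finset.measurable_prod _ fun i _ =>
      (hfm i).comp (hm i)).aestronglyMeasurable (Filter.Eventually.of_forall fun x => ?_)
    rw [Real.norm_of_nonneg (Finset.prod_nonneg fun i _ => (hf01 i _).1.le)]
    exact Finset.prod_le_one (fun i _ => (hf01 i _).1.le) fun i _ => (hf01 i _).2
  calc (law N).real {x | ((G.filter fun i => linForm (rowCoeff σ i) x ≤ -M).card : ℝ) ≤ t}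
      = ∫ x, Set.indicator {x : Disorder N |
          ((G.filter fun i => linForm (rowCoeff σ i) x ≤ -M).card : ℝ) ≤ t}
          (fun _ => (1 : ℝ)) x ∂(law N) := by
        rw [integral_indicator_const _ hsm]; simp
    _ ≤ ∫ x, Real.exp t * ∏ i, f i (linForm (rowCoeff σ i) x) ∂(law N) :=
        integral_mono ((integrable_const _).indicator hsm) (hpint.const_mul _) hsub
    _ = Real.exp t * ∏ i, ∫ x, f i (linForm (rowCoeff σ i) x) ∂(law N) := by
        rw [integral_const_mul, hint]
    _ ≤ Real.exp t * ∏ i, (if i ∈ G then Real.exp (-(lowerTail M / 2)) else 1) := by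
        gcongr with i
        · exact fun i _ => integral_nonneg fun x => (hf01 i _).1.le
        · split_ifs with hi
          · exact hterm i hi
          · simp [hf, hi]
    _ = Real.exp (t - lowerTail M / 2 * G.card) := by
        rw [Finset.prod_ite_mem, Finset.univ_inter, Finset.prod_const, ← Real.exp_nat_mul,
          ← Real.exp_add]
        ring_nf

theorem measurable_maskDisorder {N : ℕ} (m : Finset (Fin N × Fin N)) :
    Measurable (maskDisorder (N := N) m) := by
  refine measurable_pi_lambda _ fun k => ?_
  unfold maskDisorder
  split_ifs <;> fun_prop

theorem measurableSet_stabilitySumsBounded (N : ℕ) :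
    MeasurableSet {g : Disorder N | StabilitySumsBounded g} := by
  have : {g : Disorder N | StabilitySumsBounded g} =
      ⋂ σ : Cube N, ⋂ T : Finset (Fin N),
        {g | |∑ i ∈ T, stability g σ i| ≤ 5 * √((N : ℝ) * T.card)} := by
    ext g; simp [StabilitySumsBounded]
  rw [this]
  refine MeasurableSet.iInter fun σ => MeasurableSet.iInter fun T => ?_
  have h : Measurable fun g : Disorder N => ∑ i ∈ T, stability g σ i :=
    Finset.measurable_sum _ fun i _ => measurable_stability σ i
  exact measurableSet_le h.abs measurable_const

/-- With bounded stability sums for the frozen part of the disorder, a given configuration is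
gapped with exponentially small probability over the corner block. -/
theorem law_mem_gappedStates_splice_le {N : ℕ} (hN : 4 ≤ N) {γ δ p q : ℝ} (hγ : 0 < γ)
    (hp0 : 0 ≤ p) (hp1 : p ≤ 1) (hq : 1 / 2 ≤ q) (hq1 : q ≤ 1) {g y : Disorder N}
    (hg : StabilitySumsBounded g) (hy : StabilitySumsBounded (maskDisorder (cornerBlock N)ᶜ y))
    (σ : Cube N) :
    (law N).real {x | σ ∈ gappedStates γ δ (p • g + q • splice (cornerBlock N) (x, y))} ≤
      Real.exp (δ * N - lowerTail 160 / 8 * N) := by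
  classical
  have hN' : (4 : ℝ) ≤ N := by exact_mod_cast hN
  -- `u i` is the part of the stability not involving the resampled corner. The two sum bounds give
  -- at most `10N` over `T`, so `u i > 80` at no more than `N/8` sites. Elsewhere a row sum below
  -- `-160`, weighted by `q ≥ 1/2`, makes the stability at most `0 < γ`.
  set u : Fin N → ℝ := fun i =>
    p * stability g σ i + q * stability (maskDisorder (cornerBlock N)ᶜ y) σ i with hu
  set T := Finset.univ.filter fun i => 80 < u i with hT
  set A := Finset.univ.filter fun i : Fin N => i.val < N / 2 with hA
  have hAc : (N : ℝ) ≤ 2 * A.card + 1 := by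
    have h3 : A.card = min N (N / 2) := Fin.card_filter_val_lt
    have : N ≤ 2 * A.card + 1 := by omega
    exact_mod_cast this
  have hTN : (T.card : ℝ) ≤ N := by
    have := Finset.card_le_univ T
    rw [Fintype.card_fin] at this
    exact_mod_cast this
  have hTc : 8 * (T.card : ℝ) ≤ N := by
    have hsq : √((N : ℝ) * T.card) ≤ N := by
      refine Real.sqrt_le_iff.2 ⟨by positivity, ?_⟩
      rw [sq]; gcongr
    have h1 : 80 * (T.card : ℝ) ≤ ∑ i ∈ T, u i := by
      have h2 := Finset.card_nsmul_le_sum T u 80 fun i hi => by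
        simp only [hT, Finset.mem_filter] at hi
        exact hi.2.le
      rw [nsmul_eq_mul] at h2; linarith
    have h3 : ∑ i ∈ T, u i = p * ∑ i ∈ T, stability g σ i +
        q * ∑ i ∈ T, stability (maskDisorder (cornerBlock N)ᶜ y) σ i := by
      simp only [hu, Finset.sum_add_distrib, Finset.mul_sum]
    have h4 := (le_abs_self _).trans (hg σ T)
    have h5 := (le_abs_self _).trans (hy σ T)
    have h6 : p * ∑ i ∈ T, stability g σ i ≤ 5 * N := by
      calc _ ≤ p * (5 * N) := by gcongr; linarith
        _ ≤ 1 * (5 * N) := by gcongr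
        _ = _ := by ring
    have h7 : q * ∑ i ∈ T, stability (maskDisorder (cornerBlock N)ᶜ y) σ i ≤ 5 * N := by
      calc _ ≤ q * (5 * N) := by
            have : 0 ≤ q := by linarith
            gcongr; linarith
        _ ≤ 1 * (5 * N) := by gcongr
        _ = _ := by ring
    linarith
  -- Here `(N - 1)/2 - N/8 ≥ N/4`, which is where `4 ≤ N` is used.
  have hGc : (N : ℝ) / 4 ≤ (A \ T).card := by
    have h1 := Finset.le_card_sdiff T A
    have h2 : (A.card : ℝ) ≤ (A \ T).card + T.card := by
      have : A.card ≤ (A \ T).card + T.card := by omega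
      exact_mod_cast this
    linarith
  have hrow := law_card_row_le σ (G := A \ T) (M := 160) (t := δ * N)
    (fun i hi => by simpa [hA] using (Finset.mem_sdiff.1 hi).1) (by norm_num)
  refine (measureReal_mono ?_).trans (hrow.trans ?_)
  · intro x hx
    refine le_trans ?_ (card_unstable_le hx)
    gcongr
    intro i hi
    simp only [Finset.mem_filter, Finset.mem_sdiff, hA, hT, Finset.mem_univ, true_and,
      not_lt] at hi ⊢
    obtain ⟨⟨hiA, hiT⟩, hi⟩ := hi
    have h1 : stability (p • g + q • splice (cornerBlock N) (x, y)) σ i =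
        u i + q * linForm (rowCoeff σ i) x := by
      rw [stability_add_smul, splice_eq, ← stability_maskDisorder_cornerBlock x σ hiA]
      have h2 := stability_add_smul (maskDisorder (cornerBlock N) x)
        (maskDisorder (cornerBlock N)ᶜ y) 1 1 σ i
      rw [one_smul, one_smul] at h2
      simp only [h2, hu]
      ring
    rw [h1]
    nlinarith
  · rw [Real.exp_le_exp]
    nlinarith [lowerTail_pos 160]

/-- The event that a gapped state of the second Hamiltonian is close to the output on the first. -/
def nearbyGapped {N : ℕ} {Ω : Type*} (F : Disorder N × Ω → Cube N) (γ δ r : ℝ) :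
    Set ((Disorder N × Disorder N) × Ω) :=
  {x | ∃ σ' ∈ gappedStates γ δ x.1.2, (disagree (F (x.1.1, x.2)) σ').card ≤ r * N}

theorem measurableSet_nearbyGapped {N : ℕ} {Ω : Type*} [MeasurableSpace Ω]
    {F : Disorder N × Ω → Cube N} (hF : Measurable F) (γ δ r : ℝ) :
    MeasurableSet (nearbyGapped F γ δ r) := by
  have hF' : Measurable fun x : (Disorder N × Disorder N) × Ω => F (x.1.1, x.2) := by fun_prop
  refine measurableSet_mem_of_finite (Q := fun σ => {x | ∃ σ' ∈ gappedStates γ δ x.1.2,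
    (disagree σ σ').card ≤ r * N}) hF' fun σ => ?_
  have : {x : (Disorder N × Disorder N) × Ω | ∃ σ' ∈ gappedStates γ δ x.1.2,
      (disagree σ σ').card ≤ r * N} = ⋃ σ' : Cube N, ({x | σ' ∈ gappedStates γ δ x.1.2} ∩
        {_x | (disagree σ σ').card ≤ r * N}) := by
    ext x; simp
  rw [this]
  exact MeasurableSet.iUnion fun σ' => ((measurable_snd.comp measurable_fst)
    (measurableSet_mem_gappedStates γ δ σ')).inter (MeasurableSet.const _)

theorem measurePreserving_resample {N : ℕ} {Ω : Type*} [MeasurableSpace Ω] (ν : Measure Ω)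
    [IsProbabilityMeasure ν] (m : Finset (Fin N × Fin N)) :
    MeasurePreserving (fun z : ((Disorder N × Disorder N) × Ω) × Disorder N =>
      ((z.1.1.1, splice m (z.2, z.1.1.2)), z.1.2))
      ((((law N).prod (law N)).prod ν).prod (law N)) (((law N).prod (law N)).prod ν) := by
  have h1 := measurePreserving_prod_right_comm ((law N).prod (law N)) ν (law N)
  have h2 := (MeasurePreserving.id (law N)).prod
    ((measurePreserving_splice m).comp (Measure.measurePreserving_swap (μ := law N) (ν := law N)))
  have h3 := (h2.comp (measurePreserving_prodAssoc (law N) (law N) (law N))).prod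
    (MeasurePreserving.id ν)
  exact h3.comp h1

/-- Given everything but the corner block of the independent copy, the output on the first
Hamiltonian is frozen. Each `σ'` is then gapped with exponentially small probability, and a small
Hamming ball has small entropy. -/
theorem exists_correlatedLaw_nearbyGapped_le :
    ∃ r : ℝ, 0 < r ∧ ∃ δ₀ : ℝ, 0 < δ₀ ∧ ∃ c : ℝ, 0 < c ∧ ∀ γ δ p : ℝ, 0 < γ → δ ≤ δ₀ →
      0 ≤ p → p ≤ 1 → 1 / 2 ≤ √(1 - p ^ 2) → ∀ N : ℕ, 4 ≤ N →
      ∀ (Ω : Type*) [MeasurableSpace Ω] (ν : Measure Ω) [IsProbabilityMeasure ν]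
        (F : Disorder N × Ω → Cube N), Measurable F →
        ((correlatedLaw N p).prod ν).real (nearbyGapped F γ δ r) ≤
          4 * Real.exp (-N) + Real.exp (-c * N) := by
  classical
  set ρ := lowerTail 160 with hρ
  have hρ0 : 0 < ρ := lowerTail_pos 160
  obtain ⟨l, hl0, hl⟩ : ∃ l : ℝ, 0 < l ∧ Real.exp (-l) ≤ ρ / 32 :=
    ((Filter.eventually_gt_atTop 0).and (Real.tendsto_exp_neg_atTop_nhds_zero.eventually_le_const
      (by positivity : (0 : ℝ) < ρ / 32))).exists
  -- Of the rate `ρ/8`, the tolerance `δ`, the radius term `l r` and the entropy `exp (-l)` consume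
  -- at most `ρ/32` each, leaving `ρ/32`.
  refine ⟨ρ / (32 * l), by positivity, ρ / 32, by positivity, ρ / 32, by positivity, ?_⟩
  intro γ δ p hγ hδ hp0 hp1 hq N hN Ω _ ν _ F hF
  set r := ρ / (32 * l) with hr
  have hlr : l * r = ρ / 32 := by rw [hr]; field_simp
  have hq1 : √(1 - p ^ 2) ≤ 1 := Real.sqrt_le_one.2 (by nlinarith)
  set q := √(1 - p ^ 2) with hqdef
  have hSm := measurableSet_nearbyGapped hF γ δ r
  -- Replacing the corner of the independent copy by that of a further disorder preserves the law,
  -- and allows conditioning by Fubini.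
  have hmp := (measurePreserving_correlatedLaw_prod ν p).comp (measurePreserving_resample ν (cornerBlock N))
  rw [measureReal_def, ← hmp.measure_preimage hSm.nullMeasurableSet, ← measureReal_def]
  set base := ((law N).prod (law N)).prod ν with hbase
  set Bg : Set ((Disorder N × Disorder N) × Ω) :=
    (fun z => z.1.1) ⁻¹' {g | ¬ StabilitySumsBounded (maskDisorder Finset.univ g)} with hBg
  set By : Set ((Disorder N × Disorder N) × Ω) :=
    (fun z => z.1.2) ⁻¹' {y | ¬ StabilitySumsBounded (maskDisorder (cornerBlock N)ᶜ y)} with hBy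
  have hmm : ∀ m : Finset (Fin N × Fin N),
      MeasurableSet {g | ¬ StabilitySumsBounded (maskDisorder m g)} := fun m =>
    (measurable_maskDisorder m (measurableSet_stabilitySumsBounded N)).compl
  have hBgm : MeasurableSet Bg := (measurable_fst.comp measurable_fst) (hmm _)
  have hBym : MeasurableSet By := (measurable_snd.comp measurable_fst) (hmm _)
  set pre := ((fun x : (Disorder N × Disorder N) × Ω =>
      ((x.1.1, p • x.1.1 + √(1 - p ^ 2) • x.1.2), x.2)) ∘
      fun z : ((Disorder N × Disorder N) × Ω) × Disorder N =>
      ((z.1.1.1, splice (cornerBlock N) (z.2, z.1.1.2)), z.1.2)) ⁻¹' nearbyGapped F γ δ r with hpre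
  have hprem : MeasurableSet pre := hmp.measurable hSm
  have hgood : (base.prod (law N)).real (pre ∩ Prod.fst ⁻¹' (Bg ∪ By)ᶜ) ≤
      Real.exp (-(ρ / 32) * N) := by
    refine prod_real_le_of_section_le base (law N)
      (hprem.inter (measurable_fst (hBgm.union hBym).compl)) (by positivity) ?_
    rintro ⟨⟨g, y⟩, ω⟩
    by_cases hz : ((g, y), ω) ∈ (Bg ∪ By)ᶜ
    swap
    · have : Prod.mk ((g, y), ω) ⁻¹' (pre ∩ Prod.fst ⁻¹' (Bg ∪ By)ᶜ) = ∅ := by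
        ext x
        simp only [Set.mem_preimage, Set.mem_inter_iff, Set.mem_empty_iff_false, iff_false,
          not_and]
        exact fun _ => hz
      rw [this]; simp; positivity
    simp only [hBg, hBy, Set.mem_compl_iff, Set.mem_union, Set.mem_preimage, Set.mem_ofPred_eq,
      not_or, not_not, maskDisorder_univ] at hz
    set σ := F (g, ω) with hσ
    have hone : ∀ σ' : Cube N, (law N).real {x | (disagree σ σ').card ≤ r * N ∧
        σ' ∈ gappedStates γ δ (p • g + q • splice (cornerBlock N) (x, y))} ≤
        Real.exp (l * (r * N - (disagree σ σ').card) - 3 * ρ / 32 * N) := by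
      intro σ'
      by_cases hd : (disagree σ σ').card ≤ r * N
      swap
      · have : {x | (disagree σ σ').card ≤ r * N ∧
            σ' ∈ gappedStates γ δ (p • g + q • splice (cornerBlock N) (x, y))} = ∅ := by
          ext x; simp only [Set.mem_ofPred_eq, Set.mem_empty_iff_false, iff_false]; tauto
        rw [this]; simp; positivity
      refine (measureReal_mono fun x hx => hx.2).trans
        ((law_mem_gappedStates_splice_le hN hγ hp0 hp1 hq hq1 hz.1 hz.2 σ').trans ?_)
      rw [Real.exp_le_exp, ← hρ]
      have h1 : δ * N ≤ ρ / 32 * N := by gcongr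
      have h2 := mul_nonneg hl0.le (sub_nonneg.2 hd)
      linarith
    calc (law N).real (Prod.mk ((g, y), ω) ⁻¹' (pre ∩ Prod.fst ⁻¹' (Bg ∪ By)ᶜ))
        ≤ (law N).real {x | ∃ σ' ∈ (Finset.univ : Finset (Cube N)), (disagree σ σ').card ≤ r * N ∧
          σ' ∈ gappedStates γ δ (p • g + q • splice (cornerBlock N) (x, y))} := by
          refine measureReal_mono ?_
          rintro x ⟨⟨σ', h1, h2⟩, -⟩
          exact ⟨σ', Finset.mem_univ _, h2, h1⟩
      _ ≤ ∑ σ' : Cube N, Real.exp (l * (r * N - (disagree σ σ').card) - 3 * ρ / 32 * N) :=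
          (measureReal_exists_le _ _ _).trans (Finset.sum_le_sum fun σ' _ => hone σ')
      _ = Real.exp (l * r * N - 3 * ρ / 32 * N) *
            ∑ σ' : Cube N, Real.exp (-l) ^ (disagree σ σ').card := by
          rw [Finset.mul_sum]
          refine Finset.sum_congr rfl fun σ' _ => ?_
          rw [← Real.exp_nat_mul, ← Real.exp_add]
          ring_nf
      _ ≤ Real.exp (l * r * N - 3 * ρ / 32 * N) * Real.exp (Real.exp (-l) * N) := by
          gcongr
          exact sum_pow_card_disagree_le σ (by positivity)
      _ ≤ Real.exp (-(ρ / 32) * N) := by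
          rw [← Real.exp_add, Real.exp_le_exp, hlr]
          have : Real.exp (-l) * N ≤ ρ / 32 * N := by gcongr
          linarith
  have hbad : (base.prod (law N)).real (Prod.fst ⁻¹' (Bg ∪ By)) ≤ 4 * Real.exp (-N) := by
    have h1 : base.real Bg ≤ 2 * Real.exp (-N) := by
      have h : MeasurePreserving (fun z : (Disorder N × Disorder N) × Ω => z.1.1) base (law N) :=
        measurePreserving_fst.comp measurePreserving_fst
      rw [hBg, measureReal_def, h.measure_preimage (hmm _).nullMeasurableSet]
      exact law_not_stabilitySumsBounded_le _
    have h2 : base.real By ≤ 2 * Real.exp (-N) := by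
      have h : MeasurePreserving (fun z : (Disorder N × Disorder N) × Ω => z.1.2) base (law N) :=
        measurePreserving_snd.comp measurePreserving_fst
      rw [hBy, measureReal_def, h.measure_preimage (hmm _).nullMeasurableSet]
      exact law_not_stabilitySumsBounded_le _
    rw [measureReal_def, (measurePreserving_fst (μ := base) (ν := law N)).measure_preimage
      (hBgm.union hBym).nullMeasurableSet]
    refine (measureReal_union_le _ _).trans ?_
    linarith
  calc (base.prod (law N)).real pre
      ≤ (base.prod (law N)).real (Prod.fst ⁻¹' (Bg ∪ By) ∪ (pre ∩ Prod.fst ⁻¹' (Bg ∪ By)ᶜ)) := by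
        refine measureReal_mono fun z hz => ?_
        by_cases h : z ∈ Prod.fst ⁻¹' (Bg ∪ By)
        · exact Or.inl h
        · exact Or.inr ⟨hz, h⟩
    _ ≤ _ := measureReal_union_le _ _
    _ ≤ _ := add_le_add hbad hgood

/-! ### The noise operator and survival of the chain in a set -/

theorem sq_lintegral_le {X : Type*} [MeasurableSpace X] (μ : Measure X) [IsProbabilityMeasure μ]
    {u : X → ℝ≥0∞} (hu : Measurable u) : (∫⁻ x, u x ∂μ) ^ 2 ≤ ∫⁻ x, u x ^ 2 ∂μ := by
  have h := ENNReal.lintegral_mul_le_Lp_mul_Lq μ Real.HolderConjugate.two_two hu.aemeasurable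
    (measurable_const (a := (1 : ℝ≥0∞))).aemeasurable
  simp only [Pi.mul_apply, mul_one, ENNReal.one_rpow, lintegral_const, measure_univ] at h
  calc (∫⁻ x, u x ∂μ) ^ 2 ≤ ((∫⁻ x, u x ^ (2 : ℝ) ∂μ) ^ (1 / 2 : ℝ)) ^ 2 := by gcongr
    _ = ∫⁻ x, u x ^ 2 ∂μ := by
        rw [← ENNReal.rpow_natCast, ← ENNReal.rpow_mul]
        norm_num

theorem pow_lintegral_le {X : Type*} [MeasurableSpace X] (μ : Measure X) [IsProbabilityMeasure μ]
    {u : X → ℝ≥0∞} (hu : Measurable u) (n : ℕ) :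
    (∫⁻ x, u x ∂μ) ^ 2 ^ n ≤ ∫⁻ x, u x ^ 2 ^ n ∂μ := by
  induction n with
  | zero => simp
  | succ n ih =>
    calc (∫⁻ x, u x ∂μ) ^ 2 ^ (n + 1) = ((∫⁻ x, u x ∂μ) ^ 2 ^ n) ^ 2 := by rw [← pow_mul, pow_succ]
      _ ≤ (∫⁻ x, u x ^ 2 ^ n ∂μ) ^ 2 := by gcongr
      _ ≤ ∫⁻ x, (u x ^ 2 ^ n) ^ 2 ∂μ := sq_lintegral_le μ (hu.pow_const _)
      _ = _ := by simp_rw [← pow_mul, pow_succ]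

/-- The Ornstein–Uhlenbeck operator of correlation `p`. -/
noncomputable def noiseOp {N : ℕ} (p : ℝ) (u : Disorder N → ℝ≥0∞) (x : Disorder N) : ℝ≥0∞ :=
  ∫⁻ z, u (p • x + √(1 - p ^ 2) • z) ∂(law N)

theorem measurable_noiseOp {N : ℕ} (p : ℝ) {u : Disorder N → ℝ≥0∞} (hu : Measurable u) :
    Measurable (noiseOp p u) := by
  unfold noiseOp
  exact Measurable.lintegral_prod_right'
    (f := fun z : Disorder N × Disorder N => u (p • z.1 + √(1 - p ^ 2) • z.2)) (by fun_prop)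

theorem lintegral_mul_noiseOp {N : ℕ} (p : ℝ) {u v : Disorder N → ℝ≥0∞} (hu : Measurable u)
    (hv : Measurable v) :
    ∫⁻ x, u x * noiseOp p v x ∂(law N) = ∫⁻ z, u z.1 * v z.2 ∂(correlatedLaw N p) := by
  rw [correlatedLaw, lintegral_map (by fun_prop) (by fun_prop), lintegral_prod _ (by fun_prop)]
  refine lintegral_congr fun x => ?_
  rw [noiseOp, ← lintegral_const_mul _ (by fun_prop)]

theorem lintegral_mul_noiseOp_comm {N : ℕ} {p : ℝ} (hp : p ∈ Set.Icc (0 : ℝ) 1)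
    {u v : Disorder N → ℝ≥0∞} (hu : Measurable u) (hv : Measurable v) :
    ∫⁻ x, u x * noiseOp p v x ∂(law N) = ∫⁻ x, noiseOp p u x * v x ∂(law N) := by
  simp_rw [mul_comm (noiseOp p u _)]
  rw [lintegral_mul_noiseOp p hu hv, lintegral_mul_noiseOp p hv hu]
  conv_lhs => rw [← correlatedLaw_swap hp]
  rw [lintegral_map (by fun_prop) measurable_swap]
  simp [mul_comm]

theorem lintegral_noiseOp {N : ℕ} {p : ℝ} (hp : p ∈ Set.Icc (0 : ℝ) 1) {u : Disorder N → ℝ≥0∞}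
    (hu : Measurable u) : ∫⁻ x, noiseOp p u x ∂(law N) = ∫⁻ x, u x ∂(law N) := by
  have h := lintegral_mul_noiseOp_comm hp (measurable_const (a := (1 : ℝ≥0∞))) hu
  simpa [noiseOp] using h

/-- The operator of correlation `p` is the square of the symmetric one of correlation `√p`, so the
right side is `∫ (noiseOp (√p) u)²`. Cauchy–Schwarz and invariance of the mean conclude. -/
theorem sq_lintegral_le_lintegral_mul_noiseOp {N : ℕ} {p : ℝ} (hp : p ∈ Set.Icc (0 : ℝ) 1)
    {u : Disorder N → ℝ≥0∞} (hu : Measurable u) :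
    (∫⁻ x, u x ∂(law N)) ^ 2 ≤ ∫⁻ x, u x * noiseOp p u x ∂(law N) := by
  have hs : √p ∈ Set.Icc (0 : ℝ) 1 := ⟨Real.sqrt_nonneg p, Real.sqrt_le_one.2 hp.2⟩
  have hstep := measurePreserving_correlatedLaw_step (N := N) hs hs
  rw [Real.mul_self_sqrt hp.1] at hstep
  have hT := measurable_noiseOp (√p) hu
  have h1 : ∫⁻ x, u x * noiseOp p u x ∂(law N) =
      ∫⁻ x, noiseOp (√p) u x * noiseOp (√p) u x ∂(law N) := by
    rw [lintegral_mul_noiseOp p hu hu, ← hstep.map_eq, lintegral_map (by fun_prop) (by fun_prop),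
      lintegral_prod _ (by fun_prop), ← lintegral_mul_noiseOp_comm hs hu hT,
      lintegral_mul_noiseOp _ hu hT]
    refine lintegral_congr fun z => ?_
    rw [noiseOp, ← lintegral_const_mul _ (by fun_prop)]
  rw [h1, ← lintegral_noiseOp hs hu]
  simp_rw [← sq]
  exact sq_lintegral_le _ hT

/-- `killed p f n x` is the expectation of `∏_{k ≤ n} f(X_k)` for the noise chain from `x`. -/
noncomputable def killed {N : ℕ} (p : ℝ) (f : Disorder N → ℝ≥0∞) : ℕ → Disorder N → ℝ≥0∞
  | 0 => f
  | n + 1 => fun x => f x * noiseOp p (killed p f n) x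

theorem measurable_killed {N : ℕ} (p : ℝ) {f : Disorder N → ℝ≥0∞} (hf : Measurable f) (n : ℕ) :
    Measurable (killed p f n) := by
  induction n with
  | zero => exact hf
  | succ n ih => exact hf.mul (measurable_noiseOp p ih)

theorem mul_killed {N : ℕ} (p : ℝ) {f : Disorder N → ℝ≥0∞} (hf : ∀ x, f x * f x = f x) (n : ℕ)
    (x : Disorder N) : f x * killed p f n x = killed p f n x := by
  cases n with
  | zero => exact hf x
  | succ n => simp only [killed]; rw [← mul_assoc, hf x]

/-- With `f` as multiplication and `T` the noise operator, `killed p f n` is `(fT)^n f`. Symmetry of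
`T` moves one step at a time across the product, and `f² = f` supplies the missing factor. -/
theorem lintegral_killed_mul_killed {N : ℕ} {p : ℝ} (hp : p ∈ Set.Icc (0 : ℝ) 1)
    {f : Disorder N → ℝ≥0∞} (hf : Measurable f) (hf2 : ∀ x, f x * f x = f x) (n m : ℕ) :
    ∫⁻ x, killed p f n x * killed p f m x ∂(law N) = ∫⁻ x, killed p f (n + m) x ∂(law N) := by
  induction m generalizing n with
  | zero =>
    refine lintegral_congr fun x => ?_
    change killed p f n x * f x = killed p f n x
    rw [mul_comm, mul_killed p hf2]
  | succ m ih =>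
    have h1 : ∀ x, killed p f n x * killed p f (m + 1) x =
        killed p f n x * noiseOp p (killed p f m) x := by
      intro x
      conv_rhs => rw [← mul_killed p hf2 n x]
      simp only [killed]
      ring
    have h2 : ∀ x, noiseOp p (killed p f n) x * killed p f m x =
        killed p f (n + 1) x * killed p f m x := by
      intro x
      conv_lhs => rw [← mul_killed p hf2 m x]
      simp only [killed]
      ring
    simp_rw [h1]
    rw [lintegral_mul_noiseOp_comm hp (measurable_killed p hf n) (measurable_killed p hf m)]
    simp_rw [h2]
    rw [ih (n + 1), add_right_comm, add_assoc]

/-- Squaring doubles the length of the path, by Cauchy–Schwarz and the previous identity. This is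
why chain lengths are powers of two. -/
theorem pow_lintegral_le_lintegral_killed {N : ℕ} {p : ℝ} (hp : p ∈ Set.Icc (0 : ℝ) 1)
    {f : Disorder N → ℝ≥0∞} (hf : Measurable f) (hf2 : ∀ x, f x * f x = f x) (n : ℕ) :
    (∫⁻ x, f x ∂(law N)) ^ 2 ^ (n + 1) ≤ ∫⁻ x, killed p f (2 ^ n) x ∂(law N) := by
  induction n with
  | zero => simpa [killed] using sq_lintegral_le_lintegral_mul_noiseOp hp hf
  | succ n ih =>
    calc (∫⁻ x, f x ∂(law N)) ^ 2 ^ (n + 1 + 1)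
        = ((∫⁻ x, f x ∂(law N)) ^ 2 ^ (n + 1)) ^ 2 := by rw [← pow_mul, pow_succ]
      _ ≤ (∫⁻ x, killed p f (2 ^ n) x ∂(law N)) ^ 2 := by gcongr
      _ ≤ ∫⁻ x, killed p f (2 ^ n) x ^ 2 ∂(law N) := sq_lintegral_le _ (measurable_killed p hf _)
      _ = _ := by
        simp_rw [sq]
        rw [lintegral_killed_mul_killed hp hf hf2, ← two_mul, ← pow_succ']

/-! ### The stationary chain of Hamiltonians -/

/-- The stationary noise chain driven by a sequence of independent disorders. -/
noncomputable def chain {N : ℕ} (p : ℝ) (y : ℕ → Disorder N) : ℕ → Disorder N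
  | 0 => y 0
  | k + 1 => p • chain p y k + √(1 - p ^ 2) • y (k + 1)

/-- The law of a sequence of independent disorders. -/
noncomputable def noiseLaw (N : ℕ) : Measure (ℕ → Disorder N) :=
  Measure.infinitePi fun _ => law N

instance (N : ℕ) : IsProbabilityMeasure (noiseLaw N) := by unfold noiseLaw; infer_instance

theorem measurable_chain {N : ℕ} (p : ℝ) (k : ℕ) :
    Measurable fun y : ℕ → Disorder N => chain p y k := by
  induction k with
  | zero => exact measurable_pi_apply 0
  | succ k ih =>
    simp only [chain]
    have h := measurable_pi_apply (X := fun _ : ℕ => Disorder N) (k + 1)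
    fun_prop

theorem chain_congr {N : ℕ} (p : ℝ) {y y' : ℕ → Disorder N} {k : ℕ} (h : ∀ i ≤ k, y i = y' i) :
    chain p y k = chain p y' k := by
  induction k with
  | zero => exact h 0 le_rfl
  | succ k ih => rw [chain, chain, ih fun i hi => h i (hi.trans k.le_succ), h _ le_rfl]

theorem indepFun_chain_noise {N : ℕ} (p : ℝ) (k : ℕ) :
    IndepFun (fun (y : ℕ → Disorder N) (j : Fin (k + 1)) => chain p y j) (fun y => y (k + 1))
      (noiseLaw N) := by
  classical
  have h0 : iIndepFun (fun (i : ℕ) (y : ℕ → Disorder N) => y i) (noiseLaw N) :=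
    iIndepFun_infinitePi (X := fun _ x => x) fun _ => measurable_id
  have h1 := h0.indepFun_finset (Finset.range (k + 1)) {k + 1} (by simp)
    fun i => measurable_pi_apply i
  -- Padding by zero is harmless: the chain up to time `k` reads only the noises `0, …, k`.
  let ext : (Finset.range (k + 1) → Disorder N) → ℕ → Disorder N := fun z i =>
    if h : i ∈ Finset.range (k + 1) then z ⟨i, h⟩ else 0
  have hext : Measurable ext := by
    refine measurable_pi_lambda _ fun i => ?_
    by_cases h : i ∈ Finset.range (k + 1)
    · simp only [ext, h, dite_true]; exact measurable_pi_apply _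
    · simp only [ext, h, dite_false]; exact measurable_const
  have hψ : Measurable fun w : ({k + 1} : Finset ℕ) → Disorder N =>
      w ⟨k + 1, Finset.mem_singleton_self _⟩ := measurable_pi_apply _
  have h2 := h1.comp (φ := fun z (j : Fin (k + 1)) => chain p (ext z) j)
    (measurable_pi_lambda _ fun j => (measurable_chain p j).comp hext) hψ
  convert h2 using 1
  · ext1 y
    funext j
    refine chain_congr p fun i hi => ?_
    have : i ∈ Finset.range (k + 1) := Finset.mem_range.2 (by omega)
    simp only [ext, this, dite_true]
  · rfl

theorem measurable_chainPath {N : ℕ} (p : ℝ) (k : ℕ) :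
    Measurable fun (y : ℕ → Disorder N) (j : Fin (k + 1)) => chain p y j :=
  measurable_pi_lambda _ fun j => measurable_chain p j

theorem map_comp_chainPath_noise {N : ℕ} {Z : Type*} [MeasurableSpace Z] (p : ℝ) (k : ℕ)
    {φ : (Fin (k + 1) → Disorder N) → Z} (hφ : Measurable φ) :
    (noiseLaw N).map (fun y => (φ fun j : Fin (k + 1) => chain p y j, y (k + 1))) =
      ((noiseLaw N).map fun y => φ fun j : Fin (k + 1) => chain p y j).prod (law N) := by
  have h1 := (indepFun_chain_noise (N := N) p k).comp hφ measurable_id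
  have h2 := (indepFun_iff_map_prod_eq_prod_map_map
    (hφ.comp (measurable_chainPath p k)).aemeasurable
    (measurable_pi_apply (k + 1)).aemeasurable).1 h1
  refine h2.trans ?_
  congr 1
  exact Measure.infinitePi_map_eval _ _

/-- Markov property: integrating out the newest noise turns `killed p f m` at time `n + 1` into its
`noiseOp` at time `n`, which the factor `f` there completes to `killed p f (m + 1)`. -/
theorem lintegral_prod_chain {N : ℕ} (p : ℝ) {f : Disorder N → ℝ≥0∞} (hf : Measurable f)
    (n m : ℕ) :
    ∫⁻ y, (∏ i ∈ Finset.range n, f (chain p y i)) * killed p f m (chain p y n) ∂(noiseLaw N) =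
      ∫⁻ x, killed p f (n + m) x ∂(law N) := by
  induction n generalizing m with
  | zero =>
    simp only [Finset.range_zero, Finset.prod_empty, one_mul, zero_add, chain]
    have h : (noiseLaw N).map (fun y => y 0) = law N := Measure.infinitePi_map_eval _ _
    rw [← h, lintegral_map (measurable_killed p hf m) (measurable_pi_apply 0)]
  | succ n ih =>
    have hk := measurable_killed p hf m
    have hprod : Measurable fun w : Fin (n + 1) → Disorder N => ∏ i, f (w i) := by fun_prop
    have h1 : ∀ y : ℕ → Disorder N,
        (∏ i ∈ Finset.range (n + 1), f (chain p y i)) * killed p f m (chain p y (n + 1)) =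
        (fun z : (Fin (n + 1) → Disorder N) × Disorder N => (∏ i, f (z.1 i)) *
          killed p f m (p • z.1 (Fin.last n) + √(1 - p ^ 2) • z.2))
          ((fun j : Fin (n + 1) => chain p y j), y (n + 1)) := by
      intro y
      simp only [chain, Fin.val_last]
      rw [Finset.prod_range fun i => f (chain p y i)]
    have hm2 : Measurable fun z : (Fin (n + 1) → Disorder N) × Disorder N => (∏ i, f (z.1 i)) *
          killed p f m (p • z.1 (Fin.last n) + √(1 - p ^ 2) • z.2) := by fun_prop
    have hT := measurable_noiseOp p hk
    simp_rw [h1]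
    rw [← lintegral_map hm2 ((measurable_chainPath p n).prodMk (measurable_pi_apply _)),
      map_comp_chainPath_noise p n (φ := fun w => w) measurable_id, lintegral_prod _ hm2.aemeasurable]
    have h2 : ∀ w : Fin (n + 1) → Disorder N, ∫⁻ z, (∏ i, f (w i)) *
        killed p f m (p • w (Fin.last n) + √(1 - p ^ 2) • z) ∂(law N) =
        (∏ i, f (w i)) * noiseOp p (killed p f m) (w (Fin.last n)) := by
      intro w
      rw [lintegral_const_mul _ (by fun_prop), noiseOp]
    simp_rw [h2]
    rw [lintegral_map (by fun_prop) (measurable_chainPath p n), add_right_comm, add_assoc,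
      ← ih (m + 1)]
    refine lintegral_congr fun y => ?_
    rw [Fin.prod_univ_eq_prod_range (fun i => f (chain p y i)) (n + 1), Finset.prod_range_succ]
    simp only [killed, Fin.val_last]
    ring

/-- The chain stays in a set up to time `2 ^ n` at least with the probability of
`2 ^ (n + 1)` independent visits. -/
theorem pow_law_le_noiseLaw_chain {N : ℕ} {p : ℝ} (hp : p ∈ Set.Icc (0 : ℝ) 1)
    {S : Set (Disorder N)} (hS : MeasurableSet S) (n : ℕ) :
    (law N S) ^ 2 ^ (n + 1) ≤ noiseLaw N {y | ∀ i ≤ 2 ^ n, chain p y i ∈ S} := by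
  classical
  have hf : Measurable (S.indicator (1 : Disorder N → ℝ≥0∞)) := measurable_one.indicator hS
  have hf2 : ∀ x, S.indicator (1 : Disorder N → ℝ≥0∞) x * S.indicator (1 : Disorder N → ℝ≥0∞) x =
      S.indicator (1 : Disorder N → ℝ≥0∞) x := by
    intro x; by_cases h : x ∈ S <;> simp [h]
  have h1 := pow_lintegral_le_lintegral_killed hp hf hf2 n
  rw [lintegral_indicator_one hS] at h1
  refine h1.trans (le_of_eq ?_)
  have h2 := lintegral_prod_chain p hf (2 ^ n) 0
  rw [add_zero] at h2
  rw [← h2]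
  have hm : MeasurableSet {y : ℕ → Disorder N | ∀ i ≤ 2 ^ n, chain p y i ∈ S} := by
    have : {y : ℕ → Disorder N | ∀ i ≤ 2 ^ n, chain p y i ∈ S} =
        ⋂ i, ⋂ (_ : i ≤ 2 ^ n), (fun y => chain p y i) ⁻¹' S := by ext; simp
    rw [this]
    exact MeasurableSet.iInter fun i => MeasurableSet.iInter fun _ => measurable_chain p i hS
  rw [← lintegral_indicator_one hm]
  refine lintegral_congr fun y => ?_
  simp only [killed]
  rw [← Finset.prod_range_succ (fun i => S.indicator (1 : Disorder N → ℝ≥0∞) (chain p y i))]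
  by_cases h : ∀ i ≤ 2 ^ n, chain p y i ∈ S
  · rw [Set.indicator_of_mem (by exact h)]
    refine Finset.prod_eq_one fun i hi => ?_
    rw [Set.indicator_of_mem (h i (by simpa [Nat.lt_succ_iff] using hi))]
    rfl
  · rw [Set.indicator_of_notMem (by exact h)]
    push Not at h
    obtain ⟨i, hi, hiS⟩ := h
    exact Finset.prod_eq_zero (Finset.mem_range.2 (Nat.lt_succ_of_le hi))
      (Set.indicator_of_notMem hiS _)

/-- The seed is shared by all times: the chain bound is applied for each fixed seed, and Jensen's
inequality takes the power outside the average over seeds. -/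
theorem pow_prod_le_noiseLaw_prod {N : ℕ} {Ω : Type*} [MeasurableSpace Ω] (ν : Measure Ω)
    [IsProbabilityMeasure ν] {p : ℝ} (hp : p ∈ Set.Icc (0 : ℝ) 1)
    {S : Set (Disorder N × Ω)} (hS : MeasurableSet S) (n : ℕ) :
    ((law N).prod ν).real S ^ 2 ^ (n + 1) ≤
      ((noiseLaw N).prod ν).real {z | ∀ i ≤ 2 ^ n, (chain p z.1 i, z.2) ∈ S} := by
  have hm : MeasurableSet {z : (ℕ → Disorder N) × Ω | ∀ i ≤ 2 ^ n, (chain p z.1 i, z.2) ∈ S} := by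
    have : {z : (ℕ → Disorder N) × Ω | ∀ i ≤ 2 ^ n, (chain p z.1 i, z.2) ∈ S} =
        ⋂ i, ⋂ (_ : i ≤ 2 ^ n), (fun z : (ℕ → Disorder N) × Ω => (chain p z.1 i, z.2)) ⁻¹' S := by
      ext; simp
    rw [this]
    exact MeasurableSet.iInter fun i => MeasurableSet.iInter fun _ =>
      (((measurable_chain p i).comp measurable_fst).prodMk measurable_snd) hS
  rw [measureReal_def, measureReal_def, ← ENNReal.toReal_pow]
  refine ENNReal.toReal_mono (measure_ne_top _ _) ?_
  rw [Measure.prod_apply_symm hS, Measure.prod_apply_symm hm]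
  refine (pow_lintegral_le ν (measurable_measure_prodMk_right hS) _).trans ?_
  exact lintegral_mono fun ω => pow_law_le_noiseLaw_chain hp (measurable_prodMk_right hS) n

theorem map_chain {N : ℕ} {p : ℝ} (hp : p ∈ Set.Icc (0 : ℝ) 1) (k : ℕ) :
    (noiseLaw N).map (fun y => chain p y k) = law N := by
  induction k with
  | zero => exact Measure.infinitePi_map_eval _ _
  | succ k ih =>
    have hab : p ^ 2 + (√(1 - p ^ 2)) ^ 2 = 1 := by
      rw [Real.sq_sqrt (by nlinarith [hp.1, hp.2])]; ring
    have h := map_comp_chainPath_noise (N := N) p k (φ := fun w => w (Fin.last k))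
      (measurable_pi_apply _)
    simp only [Fin.val_last, ih] at h
    rw [← (measurePreserving_add_law (N := N) hab).map_eq, ← h,
      Measure.map_map (by fun_prop) ((measurable_chain p k).prodMk (measurable_pi_apply _))]
    rfl

theorem map_chain_pair {N : ℕ} {p : ℝ} (hp : p ∈ Set.Icc (0 : ℝ) 1) (j l : ℕ) :
    (noiseLaw N).map (fun y => (chain p y j, chain p y (j + l))) = correlatedLaw N (p ^ l) := by
  induction l with
  | zero =>
    have h1 : correlatedLaw N (p ^ 0) = (law N).map fun x => (x, x) := by
      rw [correlatedLaw]
      have h2 := (measurePreserving_fst (μ := law N) (ν := law N)).map_eq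
      conv_rhs => rw [← h2]
      rw [Measure.map_map (by fun_prop) (by fun_prop)]
      congr 1
      ext x <;> simp
    rw [h1, ← map_chain hp j, Measure.map_map (by fun_prop) (measurable_chain p j)]
    rfl
  | succ l ih =>
    have h := map_comp_chainPath_noise (N := N) p (j + l)
      (φ := fun w => (w ⟨j, by omega⟩, w (Fin.last (j + l))))
      ((measurable_pi_apply _).prodMk (measurable_pi_apply _))
    simp only [Fin.val_last, ih] at h
    have hpl : p ^ l ∈ Set.Icc (0 : ℝ) 1 := ⟨pow_nonneg hp.1 l, pow_le_one₀ hp.1 hp.2⟩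
    rw [pow_succ, ← (measurePreserving_correlatedLaw_step (N := N) hpl hp).map_eq, ← h,
      Measure.map_map (by fun_prop) (((measurable_chain p j).prodMk
        (measurable_chain p (j + l))).prodMk (measurable_pi_apply _))]
    rfl

theorem noiseLaw_prod_chain_pair_le {N : ℕ} {Ω : Type*} [MeasurableSpace Ω] (ν : Measure Ω)
    [IsProbabilityMeasure ν] {p : ℝ} (hp : p ∈ Set.Icc (0 : ℝ) 1) (j l : ℕ)
    (s : Set ((Disorder N × Disorder N) × Ω)) :
    ((noiseLaw N).prod ν).real {z | ((chain p z.1 j, chain p z.1 (j + l)), z.2) ∈ s} ≤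
      ((correlatedLaw N (p ^ l)).prod ν).real s := by
  have h : MeasurePreserving (fun y : ℕ → Disorder N => (chain p y j, chain p y (j + l)))
      (noiseLaw N) (correlatedLaw N (p ^ l)) :=
    ⟨(measurable_chain p j).prodMk (measurable_chain p (j + l)), map_chain_pair hp j l⟩
  have h2 := h.prod (MeasurePreserving.id ν)
  rw [measureReal_def, measureReal_def]
  refine ENNReal.toReal_mono (measure_ne_top _ _) ?_
  conv_rhs => rw [← h2.map_eq]
  exact Measure.le_map_apply h2.aemeasurable s

/-! ### Hamming distance along a path of outputs -/

theorem card_disagree_triangle {N : ℕ} (σ₁ σ₂ σ₃ : Cube N) :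
    ((disagree σ₁ σ₃).card : ℝ) ≤ (disagree σ₁ σ₂).card + (disagree σ₂ σ₃).card := by
  exact_mod_cast hammingDist_triangle σ₁ σ₂ σ₃

theorem card_disagree_self {N : ℕ} (σ : Cube N) : (disagree σ σ).card = 0 :=
  hammingDist_self σ

theorem norm_spinVec_sub_sq {N : ℕ} (σ σ' : Cube N) :
    ‖spinVec σ - spinVec σ'‖ ^ 2 = 4 * (disagree σ σ').card := by
  rw [EuclideanSpace.real_norm_sq_eq]
  have h : ∀ i, (spinVec σ - spinVec σ') i ^ 2 = if i ∈ disagree σ σ' then 4 else 0 := by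
    intro i
    rw [PiLp.sub_apply]
    split_ifs with hi
    · rw [spinVec_of_mem_disagree hi]
      linear_combination 4 * spinVec_sq σ i
    · rw [spinVec_of_notMem_disagree hi]; simp
  simp_rw [h]
  simp [mul_comm]

theorem card_disagree_lt_of_norm_lt {N : ℕ} (hN : 0 < N) {σ σ' : Cube N} {t : ℝ}
    (h : ‖spinVec σ - spinVec σ'‖ / √(N : ℝ) < 2 * t) : (disagree σ σ').card < t ^ 2 * N := by
  have hN' : (0 : ℝ) < N := by exact_mod_cast hN
  rw [div_lt_iff₀ (Real.sqrt_pos.2 hN')] at h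
  have h1 := pow_lt_pow_left₀ h (norm_nonneg _) two_ne_zero
  rw [norm_spinVec_sub_sq, mul_pow, Real.sq_sqrt hN'.le] at h1
  nlinarith

/-- A path of configurations with small steps that never sits at an intermediate distance from the
start of its current window cannot move far. -/
theorem card_disagree_path_le {N : ℕ} (σ : ℕ → Cube N) {W m : ℕ} {a η : ℝ} (ha : 0 ≤ a)
    (haη : a ≤ η / 2)
    (hstep : ∀ k < W * m, ((disagree (σ k) (σ (k + 1))).card : ℝ) ≤ η / 2 * N)
    (hgap : ∀ w < W, ∀ l ≤ m, a * N ≤ (disagree (σ (w * m)) (σ (w * m + l))).card →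
      η * N < (disagree (σ (w * m)) (σ (w * m + l))).card) :
    ((disagree (σ 0) (σ (W * m))).card : ℝ) ≤ W * a * N := by
  have hN0 : (0 : ℝ) ≤ N := Nat.cast_nonneg N
  have haN : a * N ≤ η / 2 * N := by gcongr
  have hwin : ∀ w < W, ∀ l ≤ m,
      ((disagree (σ (w * m)) (σ (w * m + l))).card : ℝ) ≤ a * N := by
    intro w hw l
    induction l with
    | zero => intro _; rw [add_zero, card_disagree_self]; simpa using mul_nonneg ha hN0
    | succ l ih =>
      intro hl
      -- A first exit beyond `aN` must land beyond `ηN`, but `aN` plus one step is at most `ηN`.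
      by_contra! hcon
      have h1 := hgap w hw (l + 1) hl hcon.le
      have h2 := card_disagree_triangle (σ (w * m)) (σ (w * m + l)) (σ (w * m + (l + 1)))
      have h3 := ih (by omega)
      have h4 : w * m + l < W * m := by
        have : (w + 1) * m ≤ W * m := Nat.mul_le_mul_right m hw
        rw [add_mul, one_mul] at this
        omega
      have h5 := hstep _ h4
      rw [add_assoc] at h5
      linarith
  have hall : ∀ w ≤ W, ((disagree (σ 0) (σ (w * m))).card : ℝ) ≤ w * a * N := by
    intro w
    induction w with
    | zero => intro _; rw [zero_mul, card_disagree_self]; simp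
    | succ w ih =>
      intro hw
      have h1 := ih (by omega)
      have h2 := hwin w (by omega) m le_rfl
      have h3 := card_disagree_triangle (σ 0) (σ (w * m)) (σ ((w + 1) * m))
      rw [add_mul, one_mul] at h3 ⊢
      push_cast
      linarith
  exact hall W le_rfl

/-! ### Combining the estimates -/

/-- Taking roots in a bound for a high power of a probability. -/
theorem le_exp_add_rpow_of_pow_le {K : ℕ} (hK : 0 < K) {P u C c c₀ x : ℝ} (hP : 0 ≤ P)
    (hu0 : 0 ≤ u) (hu1 : u ≤ 1) (hC : 0 ≤ C) (hx : 0 ≤ x) (hc : 0 ≤ c)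
    (hcK : c ≤ 1 / (2 * K : ℝ)) (hcc : c ≤ c₀ / (4 * K : ℝ))
    (hCx : C ≤ Real.exp (c₀ / 2 * x))
    (h : P ^ (2 * K) ≤ K * u + C * Real.exp (-c₀ * x)) :
    P ≤ Real.exp (-c * x) + 2 * u ^ c := by
  have hK' : (1 : ℝ) ≤ K := by exact_mod_cast hK
  have he0 : (0 : ℝ) ≤ 1 / (2 * K) := by positivity
  have he1 : 1 / (2 * K : ℝ) ≤ 1 := by rw [div_le_one (by positivity)]; linarith
  have h1 : P = (P ^ (2 * K)) ^ (1 / (2 * K) : ℝ) := by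
    have := Real.pow_rpow_inv_natCast hP (n := 2 * K) (by omega)
    rw [one_div]
    push_cast at this
    exact this.symm
  have h2 : (K * u : ℝ) ^ (1 / (2 * K) : ℝ) ≤ 2 * u ^ c := by
    rw [Real.mul_rpow (by positivity) hu0]
    -- This crude bound is the factor `2` in front of the instability term.
    have h3 : (K : ℝ) ^ (1 / (2 * K) : ℝ) ≤ 2 := by
      have h4 : (K : ℝ) ≤ 2 ^ (2 * K : ℝ) := by
        have h5 : K ≤ 2 ^ (2 * K) := (Nat.lt_two_pow_self (n := K)).le.trans
          (Nat.pow_le_pow_right two_pos (by omega))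
        have h6 : (K : ℝ) ≤ (2 : ℝ) ^ (2 * K : ℕ) := by exact_mod_cast h5
        rw [← Real.rpow_natCast] at h6
        push_cast at h6
        exact h6
      calc (K : ℝ) ^ (1 / (2 * K) : ℝ) ≤ (2 ^ (2 * K : ℝ)) ^ (1 / (2 * K) : ℝ) :=
            Real.rpow_le_rpow (by positivity) h4 he0
        _ = 2 := by
            rw [← Real.rpow_mul (by norm_num), mul_one_div_cancel (by positivity), Real.rpow_one]
    have h5 : u ^ (1 / (2 * K) : ℝ) ≤ u ^ c := Real.rpow_le_rpow_of_exponent_ge' hu0 hu1 hc hcK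
    exact mul_le_mul h3 h5 (Real.rpow_nonneg hu0 _) (by norm_num)
  have h3 : (C * Real.exp (-c₀ * x)) ^ (1 / (2 * K) : ℝ) ≤ Real.exp (-c * x) := by
    have h4 : C * Real.exp (-c₀ * x) ≤ Real.exp (-(c₀ / 2) * x) := by
      calc _ ≤ Real.exp (c₀ / 2 * x) * Real.exp (-c₀ * x) := by gcongr
        _ = _ := by rw [← Real.exp_add]; ring_nf
    calc _ ≤ (Real.exp (-(c₀ / 2) * x)) ^ (1 / (2 * K) : ℝ) :=
          Real.rpow_le_rpow (by positivity) h4 he0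
      _ = Real.exp (-(c₀ / (4 * K)) * x) := by
          rw [← Real.exp_mul]; congr 1; field_simp; ring
      _ ≤ _ := by rw [Real.exp_le_exp]; nlinarith
  calc P = (P ^ (2 * K)) ^ (1 / (2 * K) : ℝ) := h1
    _ ≤ (K * u + C * Real.exp (-c₀ * x)) ^ (1 / (2 * K) : ℝ) :=
        Real.rpow_le_rpow (by positivity) h he0
    _ ≤ (K * u) ^ (1 / (2 * K) : ℝ) + (C * Real.exp (-c₀ * x)) ^ (1 / (2 * K) : ℝ) :=
        Real.rpow_add_le_add_rpow (by positivity) (by positivity) he0 he1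
    _ ≤ _ := by linarith

theorem measurableSet_success {N : ℕ} {Ω : Type*} [MeasurableSpace Ω]
    {F : Disorder N × Ω → Cube N} (hF : Measurable F) (γ δ : ℝ) :
    MeasurableSet {x : Disorder N × Ω | F x ∈ gappedStates γ δ x.1} :=
  measurableSet_mem_of_finite (Q := fun σ => {x | σ ∈ gappedStates γ δ x.1}) hF fun σ =>
    measurable_fst (measurableSet_mem_gappedStates γ δ σ)

/-- All outputs along the chain being gapped forces one of three failures: an unstable step (`E₁`),
a gapped output at intermediate distance from its window's start (`E₂`), or a final gapped output
near the initial one (`E₃`). Otherwise the path bound confines the last output to the forbidden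
ball. -/
theorem successProb_pow_le {N : ℕ} (hN : 0 < N) {Ω : Type*} [MeasurableSpace Ω] (ν : Measure Ω)
    [IsProbabilityMeasure ν] (A : Algorithm N Ω) {γ δ a η r L τ u p b b' : ℝ} {w m : ℕ}
    (hst : A.IsStable ν L τ u) (hp : p ∈ Set.Icc (0 : ℝ) 1)
    (hLp : L * (1 - p) ^ (1 / 4 : ℝ) ≤ τ) (hτη : τ ^ 2 ≤ η / 2) (ha : 0 ≤ a) (haη : a ≤ η / 2)
    (har : (2 ^ w : ℕ) * a ≤ r)
    (hb : ∀ l ≤ 2 ^ m,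
      ((correlatedLaw N (p ^ l)).prod ν).real (intermediateGapped A.run γ δ a η) ≤ b)
    (hb' : ((correlatedLaw N (p ^ (2 ^ w * 2 ^ m))).prod ν).real
      (nearbyGapped A.run γ δ r) ≤ b') :
    A.successProb ν γ δ ^ (2 * 2 ^ (w + m)) ≤
      (2 ^ (w + m) : ℕ) * u + (2 ^ w * (2 ^ m + 1) : ℕ) * b + b' := by
  classical
  set W := 2 ^ w with hW
  set M := 2 ^ m with hM
  have hK : 2 ^ (w + m) = W * M := pow_add 2 w m
  set unst : Set ((Disorder N × Disorder N) × Ω) := {x | L * (1 - p) ^ (1 / 4 : ℝ) + τ ≤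
        ‖spinVec (A.run (x.1.1, x.2)) - spinVec (A.run (x.1.2, x.2))‖ / √(N : ℝ)} with hunst
  set Pr := (noiseLaw N).prod ν with hPr
  set E₁ : Set ((ℕ → Disorder N) × Ω) := {z | ∃ k ∈ Finset.range (W * M),
    ((chain p z.1 k, chain p z.1 (k + 1)), z.2) ∈ unst} with hE₁
  set E₂ : Set ((ℕ → Disorder N) × Ω) := {z | ∃ v ∈ Finset.range W, ∃ l ∈ Finset.range (M + 1),
    ((chain p z.1 (v * M), chain p z.1 (v * M + l)), z.2) ∈ intermediateGapped A.run γ δ a η}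
    with hE₂
  set E₃ : Set ((ℕ → Disorder N) × Ω) :=
    {z | ((chain p z.1 0, chain p z.1 (0 + W * M)), z.2) ∈ nearbyGapped A.run γ δ r} with hE₃
  have h₁ : Pr.real E₁ ≤ (W * M : ℕ) * u := by
    refine (measureReal_exists_le _ _ _).trans ?_
    have : ∀ k ∈ Finset.range (W * M), Pr.real {z : (ℕ → Disorder N) × Ω |
        ((chain p z.1 k, chain p z.1 (k + 1)), z.2) ∈ unst} ≤ u := by
      intro k _
      refine (noiseLaw_prod_chain_pair_le ν hp k 1 unst).trans ?_
      rw [pow_one]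
      exact hst p hp
    refine (Finset.sum_le_card_nsmul _ _ _ this).trans ?_
    rw [Finset.card_range, nsmul_eq_mul]
  have h₂ : Pr.real E₂ ≤ (W * (M + 1) : ℕ) * b := by
    refine (measureReal_exists_le _ _ _).trans ?_
    have : ∀ v ∈ Finset.range W, Pr.real {z : (ℕ → Disorder N) × Ω | ∃ l ∈ Finset.range (M + 1),
        ((chain p z.1 (v * M), chain p z.1 (v * M + l)), z.2) ∈
          intermediateGapped A.run γ δ a η} ≤ (M + 1 : ℕ) * b := by
      intro v _
      refine (measureReal_exists_le _ _ _).trans ?_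
      refine (Finset.sum_le_card_nsmul _ _ b fun l hl => ?_).trans ?_
      · refine (noiseLaw_prod_chain_pair_le ν hp (v * M) l _).trans (hb l ?_)
        have := Finset.mem_range.1 hl
        omega
      · rw [Finset.card_range, nsmul_eq_mul]
    refine (Finset.sum_le_card_nsmul _ _ _ this).trans ?_
    rw [Finset.card_range, nsmul_eq_mul]
    push_cast
    linarith
  have h₃ : Pr.real E₃ ≤ b' := (noiseLaw_prod_chain_pair_le ν hp 0 (W * M) _).trans hb'
  have hpow := pow_prod_le_noiseLaw_prod ν hp (measurableSet_success A.measurable_run γ δ) (w + m)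
  rw [pow_succ'] at hpow
  refine hpow.trans ?_
  rw [hK]
  calc _ ≤ Pr.real (E₁ ∪ E₂ ∪ E₃) := by
        refine measureReal_mono ?_
        intro z hz
        by_contra hcon
        simp only [Set.mem_union, not_or] at hcon
        obtain ⟨⟨hn₁, hn₂⟩, hn₃⟩ := hcon
        set σ : ℕ → Cube N := fun k => A.run (chain p z.1 k, z.2) with hσ
        have hgap : ∀ k ≤ W * M, σ k ∈ gappedStates γ δ (chain p z.1 k) := fun k hk => hz k hk
        have hfar := card_disagree_path_le σ (W := W) (m := M) ha haη ?_ ?_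
        · refine hn₃ ⟨σ (0 + W * M), hgap _ (by omega), ?_⟩
          rw [zero_add]
          refine hfar.trans ?_
          gcongr
        · intro k hk
          have hns : ¬ ((chain p z.1 k, chain p z.1 (k + 1)), z.2) ∈ unst := fun h =>
            hn₁ ⟨k, Finset.mem_range.2 hk, h⟩
          simp only [hunst, Set.mem_ofPred_eq, not_le] at hns
          have h1 := card_disagree_lt_of_norm_lt hN (t := τ) (hns.trans_le (by linarith))
          refine h1.le.trans ?_
          gcongr
        · intro v hv l hl hlow
          by_contra! hup
          have hvl : v * M + l ≤ W * M := by
            have : (v + 1) * M ≤ W * M := Nat.mul_le_mul_right M hv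
            rw [add_mul, one_mul] at this
            omega
          exact hn₂ ⟨v, Finset.mem_range.2 hv, l, Finset.mem_range.2 (by omega),
            hgap _ (by omega), σ (v * M + l), hgap _ hvl, hlow, hup⟩
    _ ≤ _ := (measureReal_union_le _ _).trans (add_le_add (measureReal_union_le _ _) le_rfl)
    _ ≤ _ := by linarith

/-- With `W a = r` fixed, the decay rate `γ² W a / 288 = γ² r / 288` does not depend on `W`, while
the entropy `2 exp (-γ² W / 288)` vanishes as `W` grows. Enough windows therefore make the gap
estimate win. -/
theorem correlatedLaw_intermediateGapped_le_exp {N : ℕ} (hN : 0 < N) {Ω : Type*}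
    [MeasurableSpace Ω] (ν : Measure Ω) [IsProbabilityMeasure ν] {F : Disorder N × Ω → Cube N}
    (hF : Measurable F) {γ δ η a r W s c₀ : ℝ} (hγ : 0 < γ) (ha : 0 < a) (hδ : 4 * δ ≤ a)
    (hs0 : 0 ≤ s) (hs1 : s ≤ 1) (hsW : 1 - s ≤ 1 / W) (hW : 0 < W) (hWa : W * a = r)
    (hWr : 225 ≤ γ ^ 2 * W * r) (hWe : 2 * Real.exp (-(γ ^ 2 * W / 288)) ≤ γ ^ 2 * r / 576)
    (hc : c₀ ≤ γ ^ 2 * r / 576) (hc1 : c₀ ≤ 1)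
    (hsparse : (law N).real {g | HasLargeSparseForm γ η g} ≤ Real.exp (-c₀ * N)) :
    ((correlatedLaw N s).prod ν).real (intermediateGapped F γ δ a η) ≤
      4 * Real.exp (-c₀ * N) := by
  have hq : √(1 - s ^ 2) ^ 2 ≤ 2 / W := by
    rw [Real.sq_sqrt (by nlinarith)]
    have : 2 / W = 2 * (1 / W) := by ring
    nlinarith
  have hN0 : (0 : ℝ) ≤ N := Nat.cast_nonneg N
  have hfresh : ∀ σ, (law N).real {g | HasLargeFreshField γ a (√(1 - s ^ 2)) σ g} ≤
      Real.exp (-c₀ * N) := by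
    intro σ
    refine (law_hasLargeFreshField_le hγ ha hW hq hN σ).trans ?_
    have h1 : γ ^ 2 * W * a = γ ^ 2 * r := by rw [mul_assoc, hWa]
    rw [Real.exp_le_exp, h1]
    exact mul_le_mul_of_nonneg_right (by linarith) hN0
  have hWa2 : 225 ≤ γ ^ 2 * W ^ 2 * a := by
    have : γ ^ 2 * W ^ 2 * a = γ ^ 2 * W * r := by rw [← hWa]; ring
    rwa [this]
  have h := correlatedLaw_intermediateGapped_le ν hF hγ hN ha hδ hs1 hsW hW hWa2 hsparse hfresh
  have hexp : Real.exp (-N) ≤ Real.exp (-c₀ * N) := by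
    rw [Real.exp_le_exp]; nlinarith
  linarith

theorem mul_one_sub_rpow_le {L τ p : ℝ} {K : ℕ} (hL : 0 < L) (hτ : 0 < τ) (hK : 0 < K)
    (hLK : (L / τ) ^ 4 ≤ K) (hp1 : p ≤ 1) (hp : 1 - p ≤ 1 / K) :
    L * (1 - p) ^ (1 / 4 : ℝ) ≤ τ := by
  have hK' : (0 : ℝ) < K := by exact_mod_cast hK
  have h1 : 1 / (K : ℝ) ≤ (τ / L) ^ 4 := by
    rw [← inv_div L τ, inv_pow, one_div]
    exact inv_anti₀ (by positivity) hLK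
  have h0 : 0 ≤ 1 - p := by linarith
  calc L * (1 - p) ^ (1 / 4 : ℝ) ≤ L * ((τ / L) ^ 4) ^ (1 / 4 : ℝ) := by
        gcongr
        exact hp.trans h1
    _ = τ := by
        rw [← Real.rpow_natCast, ← Real.rpow_mul (by positivity)]
        norm_num
        field_simp

theorem exists_windowCount {γ η r : ℝ} (hγ : 0 < γ) (hη : 0 < η) (hr : 0 < r) :
    ∃ w : ℕ, r / 2 ^ w ≤ η / 2 ∧ 225 ≤ γ ^ 2 * 2 ^ w * r ∧
      2 * Real.exp (-(γ ^ 2 * 2 ^ w / 288)) ≤ γ ^ 2 * r / 576 := by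
  have h0 : Filter.Tendsto (fun w : ℕ => (2 : ℝ) ^ w) Filter.atTop Filter.atTop :=
    tendsto_pow_atTop_atTop_of_one_lt (by norm_num)
  have h1 : ∀ᶠ w : ℕ in Filter.atTop, r / (2 : ℝ) ^ w ≤ η / 2 :=
    (h0.const_div_atTop r).eventually_le_const (by positivity)
  have h2 : ∀ᶠ w : ℕ in Filter.atTop, 225 ≤ γ ^ 2 * r * (2 : ℝ) ^ w :=
    (h0.const_mul_atTop (by positivity)).eventually_ge_atTop _
  have h3 : ∀ᶠ w : ℕ in Filter.atTop,
      Real.exp (-(γ ^ 2 / 288 * (2 : ℝ) ^ w)) ≤ γ ^ 2 * r / 1152 :=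
    (Real.tendsto_exp_neg_atTop_nhds_zero.comp
      (h0.const_mul_atTop (by positivity : 0 < γ ^ 2 / 288))).eventually_le_const (by positivity)
  obtain ⟨w, hw1, hw2, hw3⟩ := (h1.and (h2.and h3)).exists
  refine ⟨w, hw1, by linarith, ?_⟩
  rw [show γ ^ 2 * 2 ^ w / 288 = γ ^ 2 / 288 * (2 : ℝ) ^ w by ring]
  linarith

end SK

/-! ### Choice of the constants -/

open SK in
theorem theorem2p2 (γ : ℝ) (hγ : 0 < γ) :
    ∃ δ : ℝ, 0 < δ ∧ ∃ τ₀ : ℝ, 0 < τ₀ ∧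
      ∀ τ : ℝ, 0 < τ → τ ≤ τ₀ → ∀ L : ℝ, 0 < L →
        ∃ c : ℝ, 0 < c ∧
          ∀ pUnstable ∈ Set.Icc (0 : ℝ) 1, ∃ N₀ : ℕ, ∀ N : ℕ, N₀ ≤ N →
            ∀ (Ω : Type*) [TopologicalSpace Ω] [PolishSpace Ω] [MeasurableSpace Ω] [BorelSpace Ω]
              (ν : Measure Ω) [IsProbabilityMeasure ν] (A : SK.Algorithm N Ω),
              A.IsStable ν L τ pUnstable →
                A.successProb ν γ δ ≤ Real.exp (-c * N) + 2 * pUnstable ^ c := by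
  obtain ⟨η, hη, c₁, hc₁, hsparse⟩ := exists_law_hasLargeSparseForm_le hγ
  obtain ⟨r, hr, δ₀, hδ₀, c₂, hc₂, hchaos⟩ := exists_correlatedLaw_nearbyGapped_le
  obtain ⟨w, hw1, hw2, hw3⟩ := exists_windowCount hγ hη hr
  set W : ℝ := 2 ^ w with hW
  have hW0 : 0 < W := by positivity
  set a := r / W with ha
  have ha0 : 0 < a := by positivity
  -- The bound `a / 4` serves the overlap gap and `δ₀` serves chaos. The value of `τ₀` makes a
  -- stable step at most `ηN/2`. The number of windows is fixed before `τ` and `L`, which affect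
  -- only the window length `2^m`.
  refine ⟨min (a / 4) δ₀, by positivity, √(η / 2), by positivity, ?_⟩
  set δ := min (a / 4) δ₀ with hδ
  intro τ hτ hττ L hL
  have hτη : τ ^ 2 ≤ η / 2 := by
    calc τ ^ 2 ≤ √(η / 2) ^ 2 := by gcongr
      _ = η / 2 := Real.sq_sqrt (by positivity)
  obtain ⟨m, hm⟩ : ∃ m : ℕ, (L / τ) ^ 4 ≤ (2 : ℝ) ^ m := by
    obtain ⟨m, hm⟩ := pow_unbounded_of_one_lt ((L / τ) ^ 4) (one_lt_two (α := ℝ))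
    exact ⟨m, hm.le⟩
  set K : ℕ := 2 ^ (w + m) with hK
  have hK0 : 0 < K := by positivity
  have hK0' : (0 : ℝ) < K := by exact_mod_cast hK0
  have hKW : (K : ℝ) = W * 2 ^ m := by rw [hK, hW, pow_add]; push_cast; ring
  have hW1 : 1 ≤ W := one_le_pow₀ (by norm_num)
  -- The correlation is at least `exp (-1/W)` within a window and exactly `exp (-1)` after all `K`
  -- steps.
  set p := Real.exp (-(1 / K : ℝ)) with hp
  have hpI : p ∈ Set.Icc (0 : ℝ) 1 :=
    ⟨(Real.exp_pos _).le, Real.exp_le_one_iff.2 (by simp)⟩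
  have h1p : 1 - p ≤ 1 / K := by linarith [Real.add_one_le_exp (-(1 / K : ℝ))]
  have hLp : L * (1 - p) ^ (1 / 4 : ℝ) ≤ τ := by
    refine mul_one_sub_rpow_le hL hτ hK0 (hm.trans ?_) hpI.2 h1p
    rw [hKW]
    exact le_mul_of_one_le_left (by positivity) hW1
  set c₀ := min (min c₁ (γ ^ 2 * r / 576)) (min c₂ 1) with hc₀
  have hc₀0 : 0 < c₀ := by positivity
  have hc₀₁ : c₀ ≤ c₁ := (min_le_left _ _).trans (min_le_left _ _)
  have hc₀₃ : c₀ ≤ γ ^ 2 * r / 576 := (min_le_left _ _).trans (min_le_right _ _)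
  have hc₀₂ : c₀ ≤ c₂ := (min_le_right _ _).trans (min_le_left _ _)
  have hc₀₄ : c₀ ≤ 1 := (min_le_right _ _).trans (min_le_right _ _)
  -- Four exponentials for each of the `W (2^m + 1)` intermediate-distance events, and five for the
  -- chaos event.
  set C : ℝ := (2 ^ w * (2 ^ m + 1) : ℕ) * 4 + 5 with hC
  have hC0 : 0 ≤ C := by positivity
  refine ⟨min (1 / (2 * K : ℝ)) (c₀ / (4 * K : ℝ)), by positivity, ?_⟩
  rintro u ⟨hu0, hu1⟩
  obtain ⟨N₁, hN₁⟩ : ∃ N₁ : ℕ, ∀ N : ℕ, N₁ ≤ N → C ≤ Real.exp (c₀ / 2 * N) := by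
    have h : Filter.Tendsto (fun N : ℕ => Real.exp (c₀ / 2 * N)) Filter.atTop Filter.atTop :=
      Real.tendsto_exp_atTop.comp
        (tendsto_natCast_atTop_atTop.const_mul_atTop (by positivity : 0 < c₀ / 2))
    exact Filter.eventually_atTop.1 (h.eventually_ge_atTop C)
  refine ⟨max N₁ 4, fun N hN Ω _ _ _ _ ν _ A hA => ?_⟩
  have hN4 : 4 ≤ N := (le_max_right _ _).trans hN
  have hNpos : 0 < N := by omega
  have hN0 : (0 : ℝ) ≤ N := Nat.cast_nonneg N
  have hexp : ∀ c : ℝ, c₀ ≤ c → Real.exp (-c * N) ≤ Real.exp (-c₀ * N) := by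
    intro c hc
    rw [Real.exp_le_exp]; nlinarith
  have hexp1 : Real.exp (-N) ≤ Real.exp (-c₀ * N) := by
    simpa using hexp 1 hc₀₄
  refine le_exp_add_rpow_of_pow_le hK0 (C := C) (c₀ := c₀) measureReal_nonneg hu0 hu1 hC0 hN0
    (by positivity) (min_le_left _ _) (min_le_right _ _) (hN₁ N ((le_max_left _ _).trans hN)) ?_
  have hmain := successProb_pow_le hNpos ν A (γ := γ) (δ := δ) (a := a) (η := η) (r := r) (w := w)
    (m := m) (b := 4 * Real.exp (-c₀ * N)) (b' := 5 * Real.exp (-c₀ * N)) hA hpI hLp hτη ha0.le hw1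
    (by push_cast; rw [ha, mul_div_cancel₀ _ hW0.ne']) ?_ ?_
  · refine hmain.trans (le_of_eq ?_)
    rw [hC]; ring
  · intro l hl
    have hpl1 : p ^ l ≤ 1 := pow_le_one₀ hpI.1 hpI.2
    have hplW : 1 - p ^ l ≤ 1 / W := by
      have h1 : p ^ l = Real.exp (-(l / K : ℝ)) := by
        rw [hp, ← Real.exp_nat_mul]; congr 1; ring
      have h2 := Real.add_one_le_exp (-(l / K : ℝ))
      have h3 : (l / K : ℝ) ≤ 1 / W := by
        have h4 : (l : ℝ) ≤ 2 ^ m := by exact_mod_cast hl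
        rw [hKW, div_le_div_iff₀ (by positivity) hW0]
        nlinarith
      rw [h1]; linarith
    exact correlatedLaw_intermediateGapped_le_exp hNpos ν A.measurable_run hγ ha0
      (by linarith [min_le_left (a / 4) δ₀]) (pow_nonneg hpI.1 l) hpl1 hplW hW0
      (mul_div_cancel₀ _ hW0.ne') hw2 hw3 hc₀₃ hc₀₄ ((hsparse N).trans (hexp _ hc₀₁))
  · have hpK : p ^ (2 ^ w * 2 ^ m) = Real.exp (-1) := by
      rw [← pow_add, ← hK, hp, ← Real.exp_nat_mul]
      congr 1
      field_simp
    rw [hpK]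
    have he : Real.exp (-1) ≤ 1 / 2 := by
      rw [Real.exp_neg, inv_le_comm₀ (Real.exp_pos _) (by norm_num)]
      have := Real.exp_one_gt_d9
      norm_num; linarith
    have he0 := Real.exp_pos (-1)
    have h := hchaos γ δ (Real.exp (-1)) hγ (min_le_right _ _) he0.le (by linarith)
      (Real.le_sqrt_of_sq_le (by nlinarith)) N hN4 Ω ν A.run A.measurable_run
    refine h.trans ?_
    linarith [hexp c₂ hc₀₂]
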